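/- Let $p$ be a prime and $d$ a natural number. Let $dx$ be the normalised Haar measure on $\mathbb{Z}_p^d$, let $\widehat{\mathbb{Z}}_p^d=(\mathbb{Q}_p/\mathbb{Z}_p)^d$ be its dual group, with characters $\chi_p(\xi\cdot x)=e^{2\pi i\{\xi\cdot x\}_p}$, where $\{\cdot\}_p$ is the $p$-adic fractional part and $\xi\cdot x=\xi_1x_1+\dots+\xi_dx_d$. Let $\|\xi\|_p=\max_i|\xi_i|_p$, where the zero class of $\mathbb{Q}_p/\mathbb{Z}_p$ has norm $0$ and the class of $t\notin\mathbb{Z}_p$ has norm $|t|_p$; let $\langle\xi\rangle=\max\{1,\|\xi\|_p\}$, $\widehat f(\xi)=\int_{\mathbb{Z}_p^d} f(x)\overline{\chi_p(\xi\cdot x)}\,dx$ and $D^\beta f(x)=\sum_{\zeta}\|\zeta\|_p^\beta\widehat f(\zeta)\chi_p(\zeta\cdot x)$. For $0\le\rho\le1$, let $\tilde S^0_{\rho,0}(\mathbb{Z}_p^d\times\widehat{\mathbb{Z}}_p^d)$ be the class of measurable functions $\sigma:\mathbb{Z}_p^d\times\widehat{\mathbb{Z}}_p^d\to\mathbb{C}$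 such that for all integers $\alpha,\beta\ge0$ there is a constant $C>0$ with $$\bigl|D_x^\beta\bigl(\sigma(x,\xi+\eta)-\sigma(x,\xi)\bigr)\bigr|\le C\,\|\eta\|_p^{\alpha}\,\langle\xi\rangle^{-\rho\alpha}\qquad\text{for all }x\in\mathbb{Z}_p^d,\ \xi,\eta\in\widehat{\mathbb{Z}}_p^d$$ (in particular these derivatives exist: the differences are integrable in $x$ and the Fourier series defining the derivatives converge absolutely). The operator $T_\sigma f(x)=\sum_{\xi}\sigma(x,\xi)\widehat f(\xi)\chi_p(\xi\cdot x)$ is defined on the linear span of the characters. A bounded operator $A$ on $L^2(\mathbb{Z}_p^d)$ is in the Schatten–von Neumann class $S_\gamma(L^2(\mathbb{Z}_p^d))$, $1\le\gamma<\infty$, if $\sum_{k\ge0}s_k(A)^\gamma<\infty$, where $s_k(A)=\inf\{\|A-B\|:\operatorname{rank}B\le k\}$ is the $k$-th singular number of $A$. **Theorem.** Let $0\le\rho\le1$ and $\sigma\in\tilde S^0_{\rho,0}(\mathbb{Z}_p^d\times\widehat{\mathbb{Z}}_p^d)$. (a) If $\rho>0$ and $1\le\gamma<\infty$, then $T_\sigma$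 extends to a bounded operator in $S_\gamma(L^2(\mathbb{Z}_p^d))$ if and only if $$\sum_{\xi\in\widehat{\mathbb{Z}}_p^d}\|\sigma(\cdot,\xi)\|_{L^\gamma(\mathbb{Z}_p^d)}^\gamma<\infty .$$ (b) $T_\sigma$ extends to a Hilbert–Schmidt operator on $L^2(\mathbb{Z}_p^d)$ if and only if $\sum_{\xi}\|\sigma(\cdot,\xi)\|_{L^2(\mathbb{Z}_p^d)}^2<\infty$. Moreover, for every bounded extension $A$ of $T_\sigma$ to $L^2(\mathbb{Z}_p^d)$ and every orthonormal basis $(e_i)$ of $L^2(\mathbb{Z}_p^d)$, $$\|A\|_{HS}^2=\sum_i\|Ae_i\|_{L^2(\mathbb{Z}_p^d)}^2=\sum_{\xi\in\widehat{\mathbb{Z}}_p^d}\|\sigma(\cdot,\xi)\|_{L^2(\mathbb{Z}_p^d)}^2$$ (both sides may be infinite). -/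

import Mathlib

open MeasureTheory
open scoped ENNReal ComplexConjugate

noncomputable section

/-! ### The group `ℤ_p^d`, its normalised Haar measure and its dual group -/

instance padicIntMeasurableSpace (p : ℕ) [Fact p.Prime] : MeasurableSpace ℤ_[p] := borel _

instance padicIntBorelSpace (p : ℕ) [Fact p.Prime] : BorelSpace ℤ_[p] := ⟨rfl⟩

/-- The compact group `ℤ_p^d`. -/
abbrev ZpPow (p : ℕ) [Fact p.Prime] (d : ℕ) : Type := Fin d → ℤ_[p]

/-- The Haar measure on `ℤ_p^d`, normalised to total mass one. -/
def zpHaar (p : ℕ) [Fact p.Prime] (d : ℕ) : Measure (ZpPow p d) :=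
  Measure.addHaarMeasure (⊤ : TopologicalSpace.PositiveCompacts (ZpPow p d))

instance zpHaar_isProbabilityMeasure (p : ℕ) [Fact p.Prime] (d : ℕ) :
    IsProbabilityMeasure (zpHaar p d) :=
  ⟨Measure.addHaarMeasure_self (K₀ := (⊤ : TopologicalSpace.PositiveCompacts (ZpPow p d)))⟩

/-- The Prüfer group `ℚ_p / ℤ_p`. It is a `ℤ_p`-module, and it carries the quotient norm: the norm
of the class of `x` is `0` if `x ∈ ℤ_p`, and `|x|_p` otherwise. -/
abbrev PruferGroup (p : ℕ) [Fact p.Prime] : Type := ℚ_[p] ⧸ (1 : Submodule ℤ_[p] ℚ_[p])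

/-- The dual group of `ℤ_p^d`, realised as `(ℚ_p / ℤ_p)^d`, with the maximum norm `‖ξ‖_p`. -/
abbrev ZpDual (p : ℕ) [Fact p.Prime] (d : ℕ) : Type := Fin d → PruferGroup p

theorem padic_norm_mul_pow_le_one (p : ℕ) [Fact p.Prime] (x : ℚ_[p]) :
    ‖x * (p : ℚ_[p]) ^ (-x.valuation).toNat‖ ≤ 1 := by
  have hp : (1 : ℝ) < p := by exact_mod_cast (Fact.out : p.Prime).one_lt
  rcases eq_or_ne x 0 with rfl | hx
  · simp
  · rw [norm_mul, Padic.norm_eq_zpow_neg_valuation hx, norm_pow, Padic.norm_p, inv_pow,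
      ← zpow_natCast, ← zpow_neg, ← zpow_add₀ (by positivity)]
    apply zpow_le_one_of_nonpos₀ hp.le
    have := Int.self_le_toNat (-x.valuation)
    omega

/-- The `p`-adic fractional part `{x}_p`. With `n = max (-ord x) 0`, so that `p ^ n * x ∈ ℤ_p`, it
is `a / p ^ n`, where `a` is the integer with `0 ≤ a < p ^ n` and `a ≡ p ^ n * x` modulo `p ^ n`. -/
def padicFract (p : ℕ) [Fact p.Prime] (x : ℚ_[p]) : ℝ :=
  (PadicInt.appr
    (⟨x * (p : ℚ_[p]) ^ (-x.valuation).toNat, padic_norm_mul_pow_le_one p x⟩ : ℤ_[p])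
    (-x.valuation).toNat : ℝ) / (p : ℝ) ^ (-x.valuation).toNat

theorem padicFract_eq_zero (p : ℕ) [Fact p.Prime] {x : ℚ_[p]} (hx : ‖x‖ ≤ 1) :
    padicFract p x = 0 := by
  have h := (Padic.norm_le_one_iff_val_nonneg x).1 hx
  have h0 : (-x.valuation).toNat = 0 := by omega
  have key : ∀ (y : ℤ_[p]) (n : ℕ), n = 0 → (PadicInt.appr y n : ℝ) = 0 := by
    rintro y n rfl
    simp [PadicInt.appr]
  exact (congrArg (fun r : ℝ => r / (p : ℝ) ^ (-x.valuation).toNat) (key _ _ h0)).trans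
    (zero_div _)

theorem padicFract_congr (p : ℕ) [Fact p.Prime] {x y : ℚ_[p]} (h : ‖x - y‖ ≤ 1) :
    padicFract p x = padicFract p y := by
  by_cases hx : ‖x‖ ≤ 1
  · have hy : ‖y‖ ≤ 1 := by
      have := Padic.nonarchimedean x (-(x - y))
      rw [norm_neg, neg_sub, add_sub_cancel] at this
      exact this.trans (max_le hx h)
    rw [padicFract_eq_zero p hx, padicFract_eq_zero p hy]
  · have hlt : ‖x - y‖ < ‖x‖ := lt_of_le_of_lt h (not_le.1 hx)
    have hn : ‖y‖ = ‖x‖ := by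
      have := IsUltrametricDist.norm_add_eq_max_of_norm_ne_norm (x := x) (y := -(x - y))
        (by rw [norm_neg]; exact hlt.ne')
      rw [norm_neg, max_eq_left hlt.le] at this
      simpa using this
    have hx0 : x ≠ 0 := by rintro rfl; simp at hx
    have hy0 : y ≠ 0 := by rintro rfl; simp [eq_comm] at hn; exact hx0 hn
    have hv : y.valuation = x.valuation := by
      have hp : (1 : ℝ) < p := by exact_mod_cast (Fact.out : p.Prime).one_lt
      rw [Padic.norm_eq_zpow_neg_valuation hx0, Padic.norm_eq_zpow_neg_valuation hy0] at hn
      have := zpow_right_injective₀ (by positivity) hp.ne' hn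
      omega
    have key : ∀ (n m : ℕ) (_ : m = n) (hx : ‖x * (p : ℚ_[p]) ^ n‖ ≤ 1)
        (hy : ‖y * (p : ℚ_[p]) ^ m‖ ≤ 1),
        (PadicInt.appr (⟨x * (p : ℚ_[p]) ^ n, hx⟩ : ℤ_[p]) n : ℝ) / (p : ℝ) ^ n
          = (PadicInt.appr (⟨y * (p : ℚ_[p]) ^ m, hy⟩ : ℤ_[p]) m : ℝ) / (p : ℝ) ^ m := by
      rintro n m rfl hx hy
      set u : ℤ_[p] := ⟨x * (p : ℚ_[p]) ^ m, hx⟩ with hu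
      set v : ℤ_[p] := ⟨y * (p : ℚ_[p]) ^ m, hy⟩ with hv'
      set w : ℤ_[p] := ⟨x - y, h⟩ with hw
      have huv : u = v + (p : ℤ_[p]) ^ m * w := by
        apply PadicInt.ext
        rw [PadicInt.coe_add, PadicInt.coe_mul, PadicInt.coe_pow, PadicInt.coe_natCast]
        change x * (p : ℚ_[p]) ^ m = y * (p : ℚ_[p]) ^ m + (p : ℚ_[p]) ^ m * (x - y)
        ring
      have hmem : u - (PadicInt.appr v m : ℤ_[p]) ∈ Ideal.span {(p : ℤ_[p]) ^ m} := by
        have h2 := PadicInt.appr_spec m v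
        have h1 : (p : ℤ_[p]) ^ m * w ∈ Ideal.span {(p : ℤ_[p]) ^ m} :=
          Ideal.mul_mem_right _ _ (Ideal.mem_span_singleton_self _)
        have h3 := Ideal.add_mem _ h2 h1
        rwa [sub_add_eq_add_sub, ← huv] at h3
      have h4 := PadicInt.zmod_congr_of_sub_mem_span m u _ _ (PadicInt.appr_spec m u) hmem
      have h5 := (ZMod.natCast_eq_natCast_iff' _ _ _).1 h4
      rw [Nat.mod_eq_of_lt (PadicInt.appr_lt _ _), Nat.mod_eq_of_lt (PadicInt.appr_lt _ _)] at h5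
      rw [h5]
    exact key _ _ (by rw [hv]) _ _

/-- The fractional part as a function on `ℚ_p / ℤ_p`. -/
def pruferFract (p : ℕ) [Fact p.Prime] (t : PruferGroup p) : ℝ :=
  Quotient.liftOn' t (padicFract p) (by
    intro x y h
    have h' := (Submodule.quotientRel_def _).1 h
    obtain ⟨z, hz⟩ := Submodule.mem_one.1 h'
    apply padicFract_congr
    rw [← hz]
    exact z.2)

/-- The pairing `ξ · x = ξ_1 x_1 + ... + ξ_d x_d`, an element of `ℚ_p / ℤ_p`. -/
def zpPairing {p : ℕ} [Fact p.Prime] {d : ℕ} (ξ : ZpDual p d) (x : ZpPow p d) : PruferGroup p :=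
  ∑ i, x i • ξ i

/-- The character `χ_p(ξ · x) = exp (2 π i {ξ · x}_p)`. -/
def zpChar {p : ℕ} [Fact p.Prime] {d : ℕ} (ξ : ZpDual p d) (x : ZpPow p d) : ℂ :=
  Complex.exp (2 * Real.pi * Complex.I * (pruferFract p (zpPairing ξ x) : ℂ))

theorem continuous_zpChar {p : ℕ} [Fact p.Prime] {d : ℕ} (ξ : ZpDual p d) :
    Continuous (zpChar ξ) := by
  have hfr : Continuous (padicFract p) := by
    rw [continuous_iff_continuousAt]
    intro x
    have : (fun _ => padicFract p x) =ᶠ[nhds x] padicFract p := by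
      filter_upwards [Metric.ball_mem_nhds x one_pos] with y hy
      apply padicFract_congr
      rw [← dist_eq_norm, dist_comm]
      exact (Metric.mem_ball.1 hy).le
    exact (continuousAt_const (y := padicFract p x)).congr this
  choose q hq using fun i => Submodule.Quotient.mk_surjective _ (ξ i)
  have hpair : ∀ x : ZpPow p d, zpPairing ξ x = Submodule.Quotient.mk (∑ i, x i • q i) := by
    intro x
    unfold zpPairing
    rw [← Submodule.mkQ_apply, map_sum]
    refine Finset.sum_congr rfl fun i _ => ?_
    rw [map_smul, Submodule.mkQ_apply, hq]
  have hcont : Continuous fun x : ZpPow p d => ∑ i, x i • q i := by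
    refine continuous_finsetSum _ fun i _ => ?_
    simp only [Algebra.smul_def]
    exact (continuous_subtype_val.comp (continuous_apply i)).mul continuous_const
  have hcomp : Continuous fun x : ZpPow p d => pruferFract p (zpPairing ξ x) := by
    have : (fun x : ZpPow p d => pruferFract p (zpPairing ξ x))
        = fun x => padicFract p (∑ i, x i • q i) := by
      funext x
      rw [hpair]
      rfl
    rw [this]
    exact hfr.comp hcont
  unfold zpChar
  fun_prop

/-- The character with frequency `ξ` as a continuous function. -/
def zpCharC {p : ℕ} [Fact p.Prime] {d : ℕ} (ξ : ZpDual p d) : C(ZpPow p d, ℂ) :=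
  ⟨zpChar ξ, continuous_zpChar ξ⟩

/-- The Hilbert space `L²(ℤ_p^d)`. -/
abbrev ZpL2 (p : ℕ) [Fact p.Prime] (d : ℕ) : Type := Lp ℂ 2 (zpHaar p d)

/-- The space `H^∞` of trigonometric polynomials, the linear span of the characters. -/
def trigPoly (p : ℕ) [Fact p.Prime] (d : ℕ) : Submodule ℂ C(ZpPow p d, ℂ) :=
  Submodule.span ℂ (Set.range zpCharC)

/-- The Fourier coefficient `∫ f(x) conj(χ_p(ξ · x)) dx`. -/
def zpFourier {p : ℕ} [Fact p.Prime] {d : ℕ} (f : ZpPow p d → ℂ) (ξ : ZpDual p d) : ℂ :=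
  ∫ x, f x * conj (zpChar ξ x) ∂(zpHaar p d)

/-! ### Hörmander classes and pseudo-differential operators -/

/-- The weight `⟨ξ⟩ = max {1, ‖ξ‖_p}`. -/
def zpWeight {p : ℕ} [Fact p.Prime] {d : ℕ} (ξ : ZpDual p d) : ℝ := max 1 ‖ξ‖

/-- The Vladimirov operator `D^β f(x) = ∑_ζ ‖ζ‖_p^β f̂(ζ) χ_p(ζ · x)`, for `β ∈ ℕ₀`. -/
def vladimirov {p : ℕ} [Fact p.Prime] {d : ℕ} (β : ℕ) (f : ZpPow p d → ℂ) (x : ZpPow p d) : ℂ :=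
  ∑' ζ : ZpDual p d, ((‖ζ‖ ^ β : ℝ) : ℂ) * zpFourier f ζ * zpChar ζ x

/-- The difference operator `φ(ξ + η) - φ(ξ)` on functions on the dual group. -/
def dualDiff {p : ℕ} [Fact p.Prime] {d : ℕ} (η : ZpDual p d) (φ : ZpDual p d → ℂ)
    (ξ : ZpDual p d) : ℂ :=
  φ (ξ + η) - φ ξ

/-- The Hörmander class of order `m` and type `(ρ, δ)` on `ℤ_p^d`. The dual group is discrete and
countable, so measurability of a symbol is measurability in `x`. The fields `integrable` and
`summable` say that the functions `D_x^β` of the differences, which the estimate is about, are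
well defined: if all of them exist as bounded functions, then their Fourier series converge
absolutely. -/
structure IsHormanderSymbol {p : ℕ} [Fact p.Prime] {d : ℕ} (m ρ δ : ℝ)
    (σ : ZpPow p d → ZpDual p d → ℂ) : Prop where
  measurable : ∀ ξ, Measurable fun x => σ x ξ
  integrable : ∀ ξ η, Integrable (fun x => dualDiff η (σ x) ξ) (zpHaar p d)
  summable : ∀ (β : ℕ) (ξ η : ZpDual p d),
    Summable fun ζ : ZpDual p d => ‖ζ‖ ^ β * ‖zpFourier (fun x => dualDiff η (σ x) ξ) ζ‖
  estimate : ∀ α β : ℕ, ∃ C : ℝ, 0 < C ∧ ∀ (x : ZpPow p d) (ξ η : ZpDual p d),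
    ‖vladimirov β (fun y => dualDiff η (σ y) ξ) x‖
      ≤ C * ‖η‖ ^ α * zpWeight ξ ^ (m - ρ * α + δ * β)

/-- The pseudo-differential operator `T_σ f(x) = ∑_ξ σ(x, ξ) f̂(ξ) χ_p(ξ · x)`. It is applied to
trigonometric polynomials `f`, for which the sum is finite. -/
def pseudoDiff {p : ℕ} [Fact p.Prime] {d : ℕ} (σ : ZpPow p d → ZpDual p d → ℂ)
    (f : ZpPow p d → ℂ) (x : ZpPow p d) : ℂ :=
  ∑' ξ : ZpDual p d, σ x ξ * zpFourier f ξ * zpChar ξ x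

/-- The bounded operator `A` on `L²(ℤ_p^d)` extends `T_σ`, which is densely defined on the
trigonometric polynomials. -/
def IsBoundedExtension {p : ℕ} [Fact p.Prime] {d : ℕ} (σ : ZpPow p d → ZpDual p d → ℂ)
    (A : ZpL2 p d →L[ℂ] ZpL2 p d) : Prop :=
  ∀ f ∈ trigPoly p d,
    (A (ContinuousMap.toLp 2 (zpHaar p d) ℂ f) : ZpPow p d → ℂ) =ᵐ[zpHaar p d] pseudoDiff σ f

/-! ### Schatten-von Neumann classes and Hilbert-Schmidt operators -/

/-- The `k`-th singular number (`k = 0, 1, ...`) of a bounded operator between Hilbert spaces, as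
an approximation number: the distance to the operators of rank at most `k`. -/
def singularNumber {H₁ H₂ : Type*} [NormedAddCommGroup H₁] [InnerProductSpace ℂ H₁]
    [NormedAddCommGroup H₂] [InnerProductSpace ℂ H₂] (T : H₁ →L[ℂ] H₂) (k : ℕ) : ℝ :=
  sInf {r : ℝ | ∃ A : H₁ →L[ℂ] H₂, (A : H₁ →ₗ[ℂ] H₂).rank ≤ k ∧ r = ‖T - A‖}

/-- Membership in the Schatten-von Neumann class `S_γ(H₁, H₂)`. -/
def IsSchatten {H₁ H₂ : Type*} [NormedAddCommGroup H₁] [InnerProductSpace ℂ H₁]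
    [NormedAddCommGroup H₂] [InnerProductSpace ℂ H₂] (γ : ℝ) (T : H₁ →L[ℂ] H₂) : Prop :=
  Summable fun k : ℕ => singularNumber T k ^ γ

/-- `T` is a Hilbert-Schmidt operator: `∑ ‖T e_i‖² < ∞` for every orthonormal basis `(e_i)`. -/
def IsHilbertSchmidt {H₁ : Type} {H₂ : Type*} [NormedAddCommGroup H₁] [InnerProductSpace ℂ H₁]
    [NormedAddCommGroup H₂] [InnerProductSpace ℂ H₂] (T : H₁ →L[ℂ] H₂) : Prop :=
  ∀ (ι : Type) (e : HilbertBasis ι ℂ H₁), Summable fun i => ‖T (e i)‖ ^ 2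

end

/-! Part (b) is Parseval's identity. The characters `χ_ξ` form an orthonormal basis, and a bounded
extension `A` maps `χ_ξ` to `σ(·, ξ) χ_ξ`, of norm `‖σ(·, ξ)‖_{L²}` since `|χ_ξ| = 1`. The sum of
`‖A e_i‖²` does not depend on the basis.

For (a), `σ` is compared with a symbol `τ` whose operator is diagonalised exactly. By the
ultrametric inequality the balls of radius `⟨ξ⟩^(ρ/2)` partition the dual group into blocks; each
block is a coset of a finite subgroup `G`, and the weight is constant on it. On the block of
representative `r`, `τ(·, ξ)` is the part of the Fourier series of `σ(·, r)` with frequencies in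
`G`. Then `T_τ` acts on the characters of the block as a convolution over `G`, so the discrete
Fourier transform of `G` diagonalises it (`blockFourier_apply_iff_isBoundedExtension`). The
eigenvalues are indexed by the characters of `G`. A Haar random `x` induces a uniformly distributed
character of `G`, so the sum of the `γ`-th powers of the eigenvalues over a block is the sum of
`‖τ(·, ξ)‖_γ^γ` over the block (`tsum_eLpNorm_blockSymbol`). A diagonal operator is in `S_γ` exactly
when its eigenvalues are `γ`-summable, which is the theorem for `τ`.

The error `σ - τ` decreases faster than every power of `⟨ξ⟩`
(`IsHormanderSymbol.exists_norm_sub_blockSymbol_le`). For frequencies in `G`, the estimate of order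
`α` for `η = ξ - r` gains `⟨ξ⟩^(-ρα/2)`; the other frequencies exceed `⟨ξ⟩^(ρ/2)`, and smoothness in
`x` makes their coefficients small. So the error changes neither side of the equivalence. The
hypotheses control only differences of `σ`, hence smoothness of `σ` itself needs that `σ(·, ξ)`
tends to zero in mean. Each side of the equivalence implies this: a Schatten operator is compact,
and the terms of a convergent series tend to zero. -/

/-! ### Singular numbers, Schatten classes and diagonal operators. -/

section SingularNumbers

open Filter Topology

variable {H₁ H₂ : Type*} [NormedAddCommGroup H₁] [InnerProductSpace ℂ H₁]
  [NormedAddCommGroup H₂] [InnerProductSpace ℂ H₂]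

theorem Orthonormal.norm_sq_sum {ι : Type*} {v : ι → H₁} (hv : Orthonormal ℂ v)
    (a : ι → ℂ) (s : Finset ι) : ‖∑ i ∈ s, a i • v i‖ ^ 2 = ∑ i ∈ s, ‖a i‖ ^ 2 := by
  rw [← @inner_self_eq_norm_sq ℂ, hv.inner_sum, map_sum]
  refine Finset.sum_congr rfl fun i _ => ?_
  rw [← Complex.normSq_eq_conj_mul_self, Complex.normSq_eq_norm_sq]
  exact Complex.ofReal_re _

theorem singularNumber_bddBelow (T : H₁ →L[ℂ] H₂) (k : ℕ) :
    BddBelow {r : ℝ | ∃ A : H₁ →L[ℂ] H₂, (A : H₁ →ₗ[ℂ] H₂).rank ≤ k ∧ r = ‖T - A‖} :=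
  ⟨0, by rintro _ ⟨A, -, rfl⟩; positivity⟩

theorem singularNumber_nonempty (T : H₁ →L[ℂ] H₂) (k : ℕ) :
    {r : ℝ | ∃ A : H₁ →L[ℂ] H₂, (A : H₁ →ₗ[ℂ] H₂).rank ≤ k ∧ r = ‖T - A‖}.Nonempty :=
  ⟨_, 0, by simp, rfl⟩

theorem singularNumber_nonneg (T : H₁ →L[ℂ] H₂) (k : ℕ) : 0 ≤ singularNumber T k :=
  le_csInf (singularNumber_nonempty T k) (by rintro _ ⟨A, -, rfl⟩; positivity)

theorem singularNumber_le (T A : H₁ →L[ℂ] H₂) {k : ℕ} (h : (A : H₁ →ₗ[ℂ] H₂).rank ≤ k) :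
    singularNumber T k ≤ ‖T - A‖ :=
  csInf_le (singularNumber_bddBelow T k) ⟨A, h, rfl⟩

theorem exists_of_singularNumber_lt {T : H₁ →L[ℂ] H₂} {k : ℕ} {r : ℝ}
    (h : singularNumber T k < r) :
    ∃ A : H₁ →L[ℂ] H₂, (A : H₁ →ₗ[ℂ] H₂).rank ≤ k ∧ ‖T - A‖ < r := by
  obtain ⟨_, ⟨A, hA, rfl⟩, h'⟩ := exists_lt_of_csInf_lt (singularNumber_nonempty T k) h
  exact ⟨A, hA, h'⟩

theorem singularNumber_antitone (T : H₁ →L[ℂ] H₂) : Antitone (singularNumber T) := by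
  intro j k hjk
  refine csInf_le_csInf (singularNumber_bddBelow T k) (singularNumber_nonempty T j) ?_
  rintro _ ⟨A, hA, rfl⟩
  exact ⟨A, hA.trans (by exact_mod_cast hjk), rfl⟩

theorem singularNumber_add_le (S T : H₁ →L[ℂ] H₂) (j k : ℕ) :
    singularNumber (S + T) (j + k) ≤ singularNumber S j + singularNumber T k := by
  refine le_of_forall_pos_le_add fun ε hε => ?_
  obtain ⟨A, hA, hA'⟩ := exists_of_singularNumber_lt
    (lt_add_of_pos_right (singularNumber S j) (half_pos hε))
  obtain ⟨B, hB, hB'⟩ := exists_of_singularNumber_lt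
    (lt_add_of_pos_right (singularNumber T k) (half_pos hε))
  have h := singularNumber_le (S + T) (A + B) (k := j + k) (by
    push_cast
    exact (LinearMap.rank_add_le _ _).trans (add_le_add hA hB))
  have h2 : ‖S + T - (A + B)‖ ≤ ‖S - A‖ + ‖T - B‖ := by
    rw [add_sub_add_comm]; exact norm_add_le _ _
  linarith

theorem singularNumber_comp_le (S : H₂ →L[ℂ] H₂) (T : H₁ →L[ℂ] H₂) (k : ℕ) :
    singularNumber (S.comp T) k ≤ ‖S‖ * singularNumber T k := by
  refine le_of_forall_pos_le_add fun ε hε => ?_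
  have hpos : 0 < ‖S‖ + 1 := by positivity
  obtain ⟨A, hA, hA'⟩ := exists_of_singularNumber_lt
    (lt_add_of_pos_right (singularNumber T k) (div_pos hε hpos))
  have h := singularNumber_le (S.comp T) (S.comp A) (k := k)
    ((LinearMap.rank_comp_le_right (A : H₁ →ₗ[ℂ] H₂) (S : H₂ →ₗ[ℂ] H₂)).trans hA)
  rw [← ContinuousLinearMap.comp_sub] at h
  have h3 : ‖S‖ * (ε / (‖S‖ + 1)) ≤ ε := by
    rw [mul_div_assoc', div_le_iff₀ hpos]
    nlinarith [norm_nonneg S]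
  calc singularNumber (S.comp T) k ≤ ‖S‖ * ‖T - A‖ := h.trans (S.opNorm_comp_le _)
    _ ≤ ‖S‖ * (singularNumber T k + ε / (‖S‖ + 1)) := by gcongr
    _ ≤ _ := by rw [mul_add]; gcongr

/-- Since `s_{2j}(S + T) ≤ s_j(S) + s_j(T)`, the singular numbers of the sum are dominated by a
summable sequence with every term repeated twice. The factor `2 ^ γ` comes from `a + b ≤ 2 max(a,
b)`; no Schatten norm is needed. -/
theorem IsSchatten.add {γ : ℝ} (hγ : 0 < γ) {S T : H₁ →L[ℂ] H₂} (hS : IsSchatten γ S)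
    (hT : IsSchatten γ T) : IsSchatten γ (S + T) := by
  set f : ℕ → ℝ := fun k => 2 ^ γ * (singularNumber S k ^ γ + singularNumber T k ^ γ) with hf
  have hsum : Summable f := (Summable.add hS hT).mul_left _
  have h2 : Summable fun n : ℕ => f (n / 2) := by
    refine (HasSum.even_add_odd (m := ∑' k, f k) (m' := ∑' k, f k) ?_ ?_).summable
    · simpa using hsum.hasSum
    · have : ∀ k : ℕ, (2 * k + 1) / 2 = k := by omega
      simpa [this] using hsum.hasSum
  refine Summable.of_nonneg_of_le (fun k => Real.rpow_nonneg (singularNumber_nonneg _ _) _)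
    (fun k => ?_) h2
  have hs := singularNumber_nonneg S (k / 2)
  have ht := singularNumber_nonneg T (k / 2)
  have h1 : singularNumber (S + T) k ≤ singularNumber S (k / 2) + singularNumber T (k / 2) :=
    (singularNumber_antitone _ (by omega : k / 2 + k / 2 ≤ k)).trans
      (singularNumber_add_le _ _ _ _)
  calc singularNumber (S + T) k ^ γ
      ≤ (2 * max (singularNumber S (k / 2)) (singularNumber T (k / 2))) ^ γ := by
        refine Real.rpow_le_rpow (singularNumber_nonneg _ _) (h1.trans ?_) hγ.le
        rw [two_mul]
        exact add_le_add (le_max_left _ _) (le_max_right _ _)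
    _ ≤ f (k / 2) := by
        rw [Real.mul_rpow (by norm_num) (le_max_of_le_left hs), hf]
        dsimp only
        gcongr
        rcases max_cases (singularNumber S (k / 2)) (singularNumber T (k / 2)) with h | h
        · rw [h.1]; exact le_add_of_nonneg_right (Real.rpow_nonneg ht _)
        · rw [h.1]; exact le_add_of_nonneg_left (Real.rpow_nonneg hs _)

theorem IsSchatten.comp_left {γ : ℝ} (hγ : 0 < γ) {T : H₁ →L[ℂ] H₂} (hT : IsSchatten γ T)
    (S : H₂ →L[ℂ] H₂) : IsSchatten γ (S.comp T) := by
  refine Summable.of_nonneg_of_le (fun k => Real.rpow_nonneg (singularNumber_nonneg _ _) _)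
    (fun k => ?_) (Summable.mul_left (‖S‖ ^ γ) hT)
  rw [← Real.mul_rpow (norm_nonneg _) (singularNumber_nonneg _ _)]
  exact Real.rpow_le_rpow (singularNumber_nonneg _ _) (singularNumber_comp_le _ _ _) hγ.le

theorem IsSchatten.sub {γ : ℝ} (hγ : 0 < γ) {S T : H₁ →L[ℂ] H₂} (hS : IsSchatten γ S)
    (hT : IsSchatten γ T) : IsSchatten γ (S - T) := by
  have h : S - T = S + (-ContinuousLinearMap.id ℂ H₂).comp T := by ext; simp [sub_eq_add_neg]
  rw [h]
  exact hS.add hγ (hT.comp_left hγ _)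

theorem IsSchatten.tendsto_singularNumber {γ : ℝ} (hγ : 0 < γ) {T : H₁ →L[ℂ] H₂}
    (hT : IsSchatten γ T) : Tendsto (singularNumber T) atTop (𝓝 0) := by
  have h := (Summable.tendsto_atTop_zero hT).rpow_const (p := γ⁻¹) (Or.inr (by positivity))
  rw [Real.zero_rpow (by positivity)] at h
  refine h.congr fun k => ?_
  rw [← Real.rpow_mul (singularNumber_nonneg _ _), mul_inv_cancel₀ hγ.ne', Real.rpow_one]

/-- If `T` expands the span of `k + 1` orthonormal vectors, mapped to multiples of themselves,
by at least `t`, then the `k`-th singular number is at least `t`. -/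
theorem le_singularNumber {ι : Type*} {v : ι → H₁} (hv : Orthonormal ℂ v) {T : H₁ →L[ℂ] H₁}
    {μ : ι → ℂ} (hT : ∀ i, T (v i) = μ i • v i) {t : ℝ} (ht : 0 ≤ t) {s : Finset ι}
    (hs : ∀ i ∈ s, t ≤ ‖μ i‖) {k : ℕ} (hk : k < s.card) : t ≤ singularNumber T k := by
  refine le_csInf (singularNumber_nonempty T k) ?_
  rintro _ ⟨A, hA, rfl⟩
  let L : (s → ℂ) →ₗ[ℂ] H₁ := Fintype.linearCombination ℂ (fun i : s => v i)
  have hL : ∀ a, L a = ∑ i, a i • v i := fun a => Fintype.linearCombination_apply ℂ _ a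
  -- An operator of rank at most `k` has a nonzero kernel vector in a space of dimension `s.card >
  -- k`; at this vector `T - A` agrees with `T`.
  have hninj : ¬ Function.Injective ((A : H₁ →ₗ[ℂ] H₁) ∘ₗ L) := by
    intro hinj
    have h2 : Module.finrank ℂ (s → ℂ)
        = Module.finrank ℂ (LinearMap.range ((A : H₁ →ₗ[ℂ] H₁) ∘ₗ L)) :=
      (LinearMap.finrank_range_of_inj hinj).symm
    have h3 : Module.rank ℂ (LinearMap.range ((A : H₁ →ₗ[ℂ] H₁) ∘ₗ L)) ≤ k := by
      refine le_trans (Submodule.rank_mono ?_) hA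
      exact LinearMap.range_comp_le_range _ _
    rw [← Module.finrank_eq_rank] at h3
    rw [Module.finrank_fintype_fun_eq_card, Fintype.card_coe] at h2
    have h4 : Module.finrank ℂ (LinearMap.range ((A : H₁ →ₗ[ℂ] H₁) ∘ₗ L)) ≤ k := by
      exact_mod_cast h3
    omega
  rw [injective_iff_map_eq_zero] at hninj
  push Not at hninj
  obtain ⟨a, ha, ha0⟩ := hninj
  have hv' : Orthonormal ℂ (fun i : s => v i) := hv.comp _ Subtype.val_injective
  have hx : ‖L a‖ ^ 2 = ∑ i, ‖a i‖ ^ 2 := by rw [hL, hv'.norm_sq_sum]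
  have hx0 : 0 < ‖L a‖ := by
    have : ‖L a‖ ≠ 0 := by
      intro h0
      rw [h0, zero_pow two_ne_zero, eq_comm,
        Finset.sum_eq_zero_iff_of_nonneg (fun _ _ => by positivity)] at hx
      exact ha0 (funext fun i => by simpa using hx i (Finset.mem_univ i))
    positivity
  have hTx : ‖T (L a)‖ ^ 2 = ∑ i, ‖a i * μ i‖ ^ 2 := by
    rw [hL, map_sum, ← hv'.norm_sq_sum]
    simp only [map_smul, hT, smul_smul]
  have h1 : t * ‖L a‖ ≤ ‖T (L a)‖ := by
    refine le_of_sq_le_sq ?_ (norm_nonneg _)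
    rw [mul_pow, hx, hTx, Finset.mul_sum]
    refine Finset.sum_le_sum fun i _ => ?_
    rw [norm_mul, mul_pow, mul_comm]
    gcongr
    exact hs i i.2
  have h2 : ‖T (L a)‖ ≤ ‖T - A‖ * ‖L a‖ := by
    have h3 := (T - A).le_opNorm (L a)
    have h4 : A (L a) = 0 := ha
    rwa [_root_.sub_apply, h4, sub_zero] at h3
  exact le_of_mul_le_mul_right (h1.trans h2) hx0

/-- The indices of a finite set are inserted in order of decreasing `‖μ i‖`. The index inserted last
has the smallest modulus, so `le_singularNumber` applies to the whole set with that modulus as `t`,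
and the `k`-th insertion is paid for by the `k`-th singular number. -/
theorem summable_of_isSchatten_diagonal {ι : Type*} {v : ι → H₁} (hv : Orthonormal ℂ v)
    {T : H₁ →L[ℂ] H₁} {μ : ι → ℂ} (hT : ∀ i, T (v i) = μ i • v i) {γ : ℝ} (hγ : 0 < γ)
    (h : IsSchatten γ T) : Summable fun i => ‖μ i‖ ^ γ := by
  classical
  refine summable_of_sum_le (c := ∑' k, singularNumber T k ^ γ)
    (fun i => Real.rpow_nonneg (norm_nonneg _) _) fun s => ?_
  have key : ∑ i ∈ s, ‖μ i‖ ^ γ ≤ ∑ k ∈ Finset.range s.card, singularNumber T k ^ γ := by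
    induction s using Finset.induction_on_min_value (fun i => ‖μ i‖) with
    | empty => simp
    | insert a s ha hmin ih =>
      rw [Finset.sum_insert ha, Finset.card_insert_of_notMem ha, Finset.sum_range_succ, add_comm]
      refine add_le_add ih (Real.rpow_le_rpow (norm_nonneg _) ?_ hγ.le)
      refine le_singularNumber hv hT (norm_nonneg _) (s := insert a s) ?_ (by
        rw [Finset.card_insert_of_notMem ha]; omega)
      intro i hi
      rcases Finset.mem_insert.1 hi with rfl | hi
      · exact le_rfl
      · exact hmin i hi
  exact key.trans (Summable.sum_le_tsum _
    (fun k _ => Real.rpow_nonneg (singularNumber_nonneg _ _) _) h)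

/-- Only finitely many terms reach `t / 2`, so a strict bound for every term outside `s` is a strict
bound for their supremum. -/
theorem exists_lt_forall_le_of_summable {ι : Type*} {a : ι → ℝ} {γ : ℝ} (hγ : 0 < γ)
    (h : Summable fun i => a i ^ γ) {t : ℝ} (ht : 0 < t) {s : Finset ι}
    (hs : ∀ i ∉ s, a i < t) : ∃ c, 0 ≤ c ∧ c < t ∧ ∀ i ∉ s, a i ≤ c := by
  have hfin : {i | t / 2 ≤ a i}.Finite := by
    have h1 := h.tendsto_cofinite_zero.eventually_lt_const (u := (t / 2) ^ γ) (by positivity)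
    rw [eventually_cofinite] at h1
    refine h1.subset fun i hi => ?_
    simp only [Set.mem_ofPred_eq, not_lt]
    exact Real.rpow_le_rpow (by positivity) hi hγ.le
  classical
  set u := hfin.toFinset \ s with hu
  by_cases hne : u.Nonempty
  · obtain ⟨j, hj, hmax⟩ := u.exists_max_image a hne
    rw [hu, Finset.mem_sdiff] at hj
    refine ⟨max (a j) (t / 2), by positivity, max_lt (hs j hj.2) (by linarith), fun i hi => ?_⟩
    by_cases h' : t / 2 ≤ a i
    · exact (hmax i (by rw [hu]; simp [hi, h'])).trans (le_max_left _ _)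
    · exact (not_le.1 h').le.trans (le_max_right _ _)
  · refine ⟨t / 2, by positivity, by linarith, fun i hi => ?_⟩
    by_contra h'
    exact hne ⟨i, by rw [hu]; simp [hi, (not_le.1 h').le]⟩

theorem HilbertBasis.hasSum_sq_norm_inner {ι : Type*} (e : HilbertBasis ι ℂ H₁) (x : H₁) :
    HasSum (fun i => ‖inner ℂ (e i) x‖ ^ 2) (‖x‖ ^ 2) := by
  have h := (e.hasSum_inner_mul_inner x x).mapL Complex.reCLM
  simp only [Complex.reCLM_apply] at h
  have h2 : (inner ℂ x x : ℂ).re = ‖x‖ ^ 2 := by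
    rw [← @inner_self_eq_norm_sq ℂ]; rfl
  rw [h2] at h
  convert h using 2 with i
  rw [← inner_conj_symm x (e i), ← Complex.normSq_eq_conj_mul_self, Complex.normSq_eq_norm_sq,
    Complex.ofReal_re]

/-- An operator which is diagonal in a Hilbert basis is close to its finite sections. -/
theorem singularNumber_diagonal_le {ι : Type*} (e : HilbertBasis ι ℂ H₁)
    {T : H₁ →L[ℂ] H₁} {μ : ι → ℂ} (hT : ∀ i, T (e i) = μ i • e i) (s : Finset ι) {c : ℝ}
    (hc : 0 ≤ c) (hs : ∀ i ∉ s, ‖μ i‖ ≤ c) : singularNumber T s.card ≤ c := by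
  classical
  let A : H₁ →L[ℂ] H₁ := ∑ i ∈ s, (innerSL ℂ (e i)).smulRight (μ i • e i)
  have hA : ∀ x, A x = ∑ i ∈ s, inner ℂ (e i) x • μ i • e i := fun x => by
    simp [A]
  have hrank : (A : H₁ →ₗ[ℂ] H₁).rank ≤ s.card := by
    have hle : LinearMap.range (A : H₁ →ₗ[ℂ] H₁)
        ≤ Submodule.span ℂ ((s.image fun i => (e i : H₁) : Finset H₁) : Set H₁) := by
      rintro _ ⟨x, rfl⟩
      rw [ContinuousLinearMap.coe_coe, hA]
      refine Submodule.sum_mem _ fun i hi => ?_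
      refine Submodule.smul_mem _ _ (Submodule.smul_mem _ _ (Submodule.subset_span ?_))
      exact Finset.mem_coe.2 (Finset.mem_image_of_mem _ hi)
    refine (Submodule.rank_mono hle).trans ((rank_span_finset_le _).trans ?_)
    exact_mod_cast Finset.card_image_le
  refine (singularNumber_le T A hrank).trans (ContinuousLinearMap.opNorm_le_bound _ hc fun x => ?_)
  have hin : ∀ i, inner ℂ (e i) ((T - A) x) = (if i ∈ s then 0 else μ i) * inner ℂ (e i) x := by
    intro i
    have h1 : HasSum (fun j => inner ℂ (e i) (T (e.repr x j • e j))) (inner ℂ (e i) (T x)) :=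
      ((e.hasSum_repr x).mapL T).mapL (innerSL ℂ (e i))
    have h2 := h1.tsum_eq
    rw [tsum_eq_single i, map_smul, hT, smul_smul, inner_smul_right,
      orthonormal_iff_ite.1 e.orthonormal, if_pos rfl, mul_one, e.repr_apply_apply] at h2
    · rw [_root_.sub_apply, inner_sub_right, ← h2, hA]
      simp only [smul_smul]
      split_ifs with h
      · rw [e.orthonormal.inner_right_sum _ h]; ring
      · rw [inner_sum, Finset.sum_eq_zero]
        · ring
        · intro j hj
          rw [inner_smul_right, orthonormal_iff_ite.1 e.orthonormal, if_neg, mul_zero]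
          rintro rfl; exact h hj
    · intro j hj
      rw [map_smul, hT, smul_smul, inner_smul_right,
        orthonormal_iff_ite.1 e.orthonormal, if_neg hj.symm, mul_zero]
  refine le_of_sq_le_sq ?_ (by positivity)
  rw [mul_pow]
  refine hasSum_le (fun i => ?_) (e.hasSum_sq_norm_inner _)
    ((e.hasSum_sq_norm_inner x).mul_left (c ^ 2))
  rw [hin, norm_mul, mul_pow]
  gcongr
  split_ifs with h
  · simpa using hc
  · exact hs i h

/-- Greedy matching: each positive singular number `s_n` is charged to a new index `i` with `s_n ≤
‖μ i‖`. Were there no such index outside the set `s` chosen so far, the finite section on `s` would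
approximate `T` to within some `c < s_n` by rank at most `n`. -/
theorem isSchatten_of_diagonal {ι : Type*} (e : HilbertBasis ι ℂ H₁)
    {T : H₁ →L[ℂ] H₁} {μ : ι → ℂ} (hT : ∀ i, T (e i) = μ i • e i) {γ : ℝ} (hγ : 0 < γ)
    (h : Summable fun i => ‖μ i‖ ^ γ) : IsSchatten γ T := by
  classical
  have hnn : ∀ i, 0 ≤ ‖μ i‖ ^ γ := fun i => Real.rpow_nonneg (norm_nonneg _) _
  refine summable_of_sum_range_le (c := ∑' i, ‖μ i‖ ^ γ)
    (fun k => Real.rpow_nonneg (singularNumber_nonneg _ _) _) fun n => ?_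
  have key : ∃ s : Finset ι, s.card ≤ n ∧
      ∑ k ∈ Finset.range n, singularNumber T k ^ γ ≤ ∑ i ∈ s, ‖μ i‖ ^ γ := by
    induction n with
    | zero => exact ⟨∅, by simp⟩
    | succ n ih =>
      obtain ⟨s, hs, hle⟩ := ih
      -- A vanishing singular number is charged to no index, as the indices may be exhausted; hence
      -- only `s.card ≤ n`.
      rcases (singularNumber_nonneg T n).eq_or_lt with h0 | hpos
      · refine ⟨s, by omega, ?_⟩
        rw [Finset.sum_range_succ, ← h0, Real.zero_rpow hγ.ne', add_zero]
        exact hle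
      · have : ∃ i ∉ s, singularNumber T n ≤ ‖μ i‖ := by
          by_contra! hcon
          obtain ⟨c, hc0, hc, hc'⟩ := exists_lt_forall_le_of_summable hγ
            h hpos hcon
          exact absurd ((singularNumber_antitone T hs).trans
            (singularNumber_diagonal_le e hT s hc0 hc')) (not_le.2 hc)
        obtain ⟨i, hi, hi'⟩ := this
        refine ⟨insert i s, by rw [Finset.card_insert_of_notMem hi]; omega, ?_⟩
        rw [Finset.sum_range_succ, Finset.sum_insert hi, add_comm]
        exact add_le_add (Real.rpow_le_rpow hpos.le hi' hγ.le) hle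
  obtain ⟨s, -, hs⟩ := key
  exact hs.trans (h.sum_le_tsum _ fun i _ => hnn i)

/-- In an orthonormal basis `u` of the range, `‖B v_i‖²` is a finite sum of `|⟨v_i, B* u_j⟩|²`, and
each of these tends to zero by Bessel's inequality. -/
theorem tendsto_norm_apply_of_finiteRank [CompleteSpace H₁] [CompleteSpace H₂] {ι : Type*}
    {v : ι → H₁} (hv : Orthonormal ℂ v)
    (B : H₁ →L[ℂ] H₂) [FiniteDimensional ℂ (LinearMap.range (B : H₁ →ₗ[ℂ] H₂))] :
    Tendsto (fun i => ‖B (v i)‖) cofinite (𝓝 0) := by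
  let u := stdOrthonormalBasis ℂ (LinearMap.range (B : H₁ →ₗ[ℂ] H₂))
  have h1 : ∀ i, ‖B (v i)‖ ^ 2
      = ∑ j, ‖inner ℂ (v i) (ContinuousLinearMap.adjoint B (u j : H₂))‖ ^ 2 := by
    intro i
    have h2 := u.sum_sq_norm_inner_right ⟨B (v i), ⟨v i, rfl⟩⟩
    simp only [Submodule.coe_norm] at h2
    rw [← h2]
    refine Finset.sum_congr rfl fun j _ => ?_
    rw [ContinuousLinearMap.adjoint_inner_right, norm_inner_symm]
    rfl
  have h3 : Tendsto (fun i => ‖B (v i)‖ ^ 2) cofinite (𝓝 0) := by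
    simp only [h1]
    rw [← Finset.sum_const_zero (s := Finset.univ) (ι := Fin _)]
    exact tendsto_finsetSum _ fun j _ => (hv.inner_products_summable _).tendsto_cofinite_zero
  have h4 := h3.sqrt
  rw [Real.sqrt_zero] at h4
  exact h4.congr fun i => Real.sqrt_sq (norm_nonneg _)

theorem IsSchatten.tendsto_norm_apply [CompleteSpace H₁] [CompleteSpace H₂] {ι : Type*}
    {v : ι → H₁} (hv : Orthonormal ℂ v) {T : H₁ →L[ℂ] H₂} {γ : ℝ} (hγ : 0 < γ)
    (hT : IsSchatten γ T) : Tendsto (fun i => ‖T (v i)‖) cofinite (𝓝 0) := by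
  rw [Metric.tendsto_nhds]
  intro ε hε
  obtain ⟨k, hk⟩ := ((hT.tendsto_singularNumber hγ).eventually_lt_const (half_pos hε)).exists
  obtain ⟨B, hB, hTB⟩ := exists_of_singularNumber_lt hk
  have : FiniteDimensional ℂ (LinearMap.range (B : H₁ →ₗ[ℂ] H₂)) :=
    Module.rank_lt_aleph0_iff.1 (hB.trans_lt (Cardinal.natCast_lt_aleph0))
  filter_upwards [(tendsto_norm_apply_of_finiteRank hv B).eventually_lt_const (half_pos hε)]
    with i hi
  rw [Real.dist_eq, sub_zero, abs_norm]
  have h1 := (T - B).le_opNorm (v i)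
  rw [hv.norm_eq_one, mul_one, _root_.sub_apply] at h1
  have h2 := norm_sub_norm_le (T (v i)) (B (v i))
  linarith

end SingularNumbers

/-! ### Construction of operators from their values on a Hilbert basis. -/

section HilbertBasisOperators

variable {H K : Type*} [NormedAddCommGroup H] [InnerProductSpace ℂ H] [CompleteSpace H]
  [NormedAddCommGroup K] [InnerProductSpace ℂ K] [CompleteSpace K]

theorem HilbertBasis.tsum_sq_enorm_inner {ι H : Type*} [NormedAddCommGroup H]
    [InnerProductSpace ℂ H] (e : HilbertBasis ι ℂ H) (x : H) :
    ∑' i, ‖inner ℂ (e i) x‖ₑ ^ 2 = ‖x‖ₑ ^ 2 := by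
  have h := e.hasSum_sq_norm_inner x
  have h2 := ENNReal.ofReal_tsum_of_nonneg (fun i => by positivity) h.summable
  rw [h.tsum_eq] at h2
  simp only [ENNReal.ofReal_pow (norm_nonneg _), ofReal_norm] at h2
  exact h2.symm

/-- Both sides are the double sum of `|⟨f_j, T e_i⟩|²`. In `[0, ∞]` the order of summation is free,
so finiteness plays no role. -/
theorem HilbertBasis.tsum_sq_enorm_apply_eq_adjoint {ι κ : Type*} (e : HilbertBasis ι ℂ H)
    (f : HilbertBasis κ ℂ K) (T : H →L[ℂ] K) :
    ∑' i, ‖T (e i)‖ₑ ^ 2 = ∑' j, ‖ContinuousLinearMap.adjoint T (f j)‖ₑ ^ 2 := by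
  simp only [← f.tsum_sq_enorm_inner, ← e.tsum_sq_enorm_inner (ContinuousLinearMap.adjoint T _)]
  rw [ENNReal.tsum_comm]
  refine tsum_congr fun j => tsum_congr fun i => ?_
  rw [ContinuousLinearMap.adjoint_inner_right, ← inner_conj_symm, RCLike.enorm_conj]

theorem HilbertBasis.tsum_sq_enorm_apply_eq {ι κ : Type*} (e : HilbertBasis ι ℂ H)
    (f : HilbertBasis κ ℂ H) (T : H →L[ℂ] K) :
    ∑' i, ‖T (e i)‖ₑ ^ 2 = ∑' j, ‖T (f j)‖ₑ ^ 2 := by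
  obtain ⟨w, g, -⟩ := exists_hilbertBasis ℂ K
  rw [e.tsum_sq_enorm_apply_eq_adjoint g, f.tsum_sq_enorm_apply_eq_adjoint g]

/-- A family satisfying a Bessel inequality is the image of a Hilbert basis under a bounded
operator. -/
theorem HilbertBasis.exists_clm_of_bessel {ι : Type*} (e : HilbertBasis ι ℂ H) (v : ι → K) (C : ℝ)
    (h : ∀ (w : K) (s : Finset ι), ∑ i ∈ s, ‖inner ℂ (v i) w‖ ^ 2 ≤ C * ‖w‖ ^ 2) :
    ∃ A : H →L[ℂ] K, ∀ i, A (e i) = v i := by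
  classical
  have hmem : ∀ w : K, Memℓp (fun i => inner ℂ (v i) w) 2 := fun w => by
    refine memℓp_gen (summable_of_sum_le (c := C * ‖w‖ ^ 2) (fun i => by positivity) fun s => ?_)
    simpa using h w s
  -- The operator is obtained as an adjoint: the Bessel inequality says that `w ↦ (⟨v i, w⟩)_i` is
  -- bounded into `ℓ²`.
  let B₀ : K →ₗ[ℂ] lp (fun _ : ι => ℂ) 2 :=
    { toFun := fun w => ⟨fun i => inner ℂ (v i) w, hmem w⟩
      map_add' := fun x y => by ext i; exact inner_add_right _ _ _
      map_smul' := fun c x => by ext i; exact inner_smul_right _ _ _ }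
  have hB₀ : ∀ w, ‖B₀ w‖ ≤ √C * ‖w‖ := fun w => by
    have hC : 0 ≤ C * ‖w‖ ^ 2 := by simpa using h w ∅
    rw [← Real.sqrt_sq (norm_nonneg w), ← Real.sqrt_mul' _ (by positivity)]
    refine Real.le_sqrt_of_sq_le ?_
    have h1 := lp.norm_rpow_eq_tsum (p := 2) (by norm_num) (B₀ w)
    simp only [ENNReal.toReal_ofNat, Real.rpow_ofNat] at h1
    rw [h1]
    exact Real.tsum_le_of_sum_le (fun i => by positivity) fun s => h w s
  let B : K →L[ℂ] H := (e.repr.symm.toContinuousLinearEquiv : _ →L[ℂ] H).comp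
    (B₀.mkContinuous _ hB₀)
  refine ⟨ContinuousLinearMap.adjoint B, fun i => ext_inner_right ℂ fun w => ?_⟩
  rw [ContinuousLinearMap.adjoint_inner_left, ← e.repr_apply_apply]
  simp [B, B₀]

theorem HilbertBasis.exists_clm_of_summable {ι : Type*} (e : HilbertBasis ι ℂ H) (v : ι → K)
    (h : Summable fun i => ‖v i‖ ^ 2) : ∃ A : H →L[ℂ] K, ∀ i, A (e i) = v i := by
  refine e.exists_clm_of_bessel v (∑' i, ‖v i‖ ^ 2) fun w s => ?_
  calc ∑ i ∈ s, ‖inner ℂ (v i) w‖ ^ 2 ≤ ∑ i ∈ s, ‖v i‖ ^ 2 * ‖w‖ ^ 2 := by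
        refine Finset.sum_le_sum fun i _ => ?_
        rw [← mul_pow]
        gcongr
        exact norm_inner_le_norm _ _
    _ ≤ _ := by
        rw [← Finset.sum_mul]
        gcongr
        exact h.sum_le_tsum _ fun i _ => by positivity

theorem HilbertBasis.exists_clm_diagonal {ι : Type*} (e : HilbertBasis ι ℂ H) (μ : ι → ℂ) (C : ℝ)
    (h : ∀ i, ‖μ i‖ ≤ C) : ∃ A : H →L[ℂ] H, ∀ i, A (e i) = μ i • e i := by
  refine e.exists_clm_of_bessel _ (C ^ 2) fun w s => ?_
  calc ∑ i ∈ s, ‖inner ℂ (μ i • e i) w‖ ^ 2 ≤ ∑ i ∈ s, C ^ 2 * ‖inner ℂ (e i) w‖ ^ 2 := by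
        refine Finset.sum_le_sum fun i _ => ?_
        rw [inner_smul_left, norm_mul, RCLike.norm_conj, mul_pow]
        gcongr
        exact h i
    _ ≤ _ := by
        rw [← Finset.mul_sum]
        gcongr
        exact e.orthonormal.sum_inner_products_le w

/-- Operators that map a Hilbert basis to a rapidly decreasing family are in all Schatten
classes. -/
theorem HilbertBasis.exists_isSchatten {ι : Type*} (e : HilbertBasis ι ℂ H) (v : ι → H)
    (w : ι → ℝ) (hw : ∀ i, 0 < w i) (hw1 : ∀ i, w i ≤ 1) (hsum : Summable w) (C : ℝ)
    (hv : ∀ i, ‖v i‖ ≤ C * w i ^ 2) {γ : ℝ} (hγ : 1 ≤ γ) :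
    ∃ A : H →L[ℂ] H, (∀ i, A (e i) = v i) ∧ IsSchatten γ A := by
  -- The factorisation is `A = B D`. The diagonal operator `D` with entries `w i` carries the
  -- Schatten property, and `B` maps `e i` to `v i / w i`, whose norms are still square summable
  -- because `v` is bounded by the square of `w`.
  obtain ⟨D, hD⟩ := e.exists_clm_diagonal (fun i => (w i : ℂ)) 1 fun i => by
    rw [Complex.norm_real, Real.norm_of_nonneg (hw i).le]; exact hw1 i
  have hDS : IsSchatten γ D := by
    refine isSchatten_of_diagonal e hD (by linarith) ?_
    refine Summable.of_nonneg_of_le (fun i => by positivity) (fun i => ?_) hsum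
    rw [Complex.norm_real, Real.norm_of_nonneg (hw i).le]
    exact Real.rpow_le_self_of_le_one (hw i).le (hw1 i) hγ
  obtain ⟨B, hB⟩ := e.exists_clm_of_summable (fun i => ((w i : ℂ)⁻¹) • v i) (by
    refine Summable.of_nonneg_of_le (fun i => by positivity) (fun i => ?_) (hsum.mul_left (C ^ 2))
    have h1 : ‖((w i : ℂ)⁻¹) • v i‖ ≤ C * w i := by
      rw [norm_smul, norm_inv, Complex.norm_real, Real.norm_of_nonneg (hw i).le,
        inv_mul_le_iff₀ (hw i)]
      exact (hv i).trans (by rw [sq]; exact le_of_eq (by ring))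
    calc ‖((w i : ℂ)⁻¹) • v i‖ ^ 2 ≤ (C * w i) ^ 2 := by gcongr
      _ = C ^ 2 * (w i * w i) := by ring
      _ ≤ C ^ 2 * w i := by
        gcongr
        exact mul_le_of_le_one_left (hw i).le (hw1 i))
  refine ⟨B.comp D, fun i => ?_, hDS.comp_left (by linarith) B⟩
  rw [ContinuousLinearMap.comp_apply, hD, map_smul, hB, smul_smul, mul_inv_cancel₀, one_smul]
  exact_mod_cast (hw i).ne'

end HilbertBasisOperators

/-! ### The block discrete Fourier transform. -/

section BlockFourier

variable {H : Type*} [NormedAddCommGroup H] [InnerProductSpace ℂ H] [CompleteSpace H]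
variable {β : Type*} {B : β → Type*} [∀ b, AddCommGroup (B b)] [∀ b, Fintype (B b)]

/-- The discrete Fourier transform, block by block, of a Hilbert basis indexed by a disjoint union
of finite abelian groups. -/
noncomputable def HilbertBasis.blockFourierVec (e : HilbertBasis (Σ b, B b) ℂ H)
    (i : Σ b, AddChar (B b) ℂ) : H :=
  ((√(Fintype.card (B i.1)) : ℝ) : ℂ)⁻¹ • ∑ ζ, conj (i.2 ζ) • e ⟨i.1, ζ⟩

omit [CompleteSpace H] in
theorem HilbertBasis.orthonormal_blockFourierVec (e : HilbertBasis (Σ b, B b) ℂ H) :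
    Orthonormal ℂ e.blockFourierVec := by
  classical
  rw [orthonormal_iff_ite]
  rintro ⟨b, ψ⟩ ⟨b', ψ'⟩
  have hoe := orthonormal_iff_ite.1 e.orthonormal
  simp only [blockFourierVec, inner_smul_left, inner_smul_right, sum_inner, inner_sum, hoe]
  by_cases hb : b = b'
  · subst hb
    have hcard : (0 : ℝ) < Fintype.card (B b) := by exact_mod_cast Fintype.card_pos
    have h1 : ∀ ζ : B b, conj (ψ' ζ) * ψ ζ = (ψ - ψ') ζ := fun ζ => by
      rw [AddChar.sub_apply, AddChar.map_neg_eq_conj, mul_comm]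
    have h2 : (Fintype.card (B b) : ℂ) = ((√(Fintype.card (B b)) : ℝ) : ℂ) ^ 2 := by
      rw [← Complex.ofReal_pow, Real.sq_sqrt hcard.le, Complex.ofReal_natCast]
    have h3 : ((√(Fintype.card (B b)) : ℝ) : ℂ) ≠ 0 := by
      rw [Complex.ofReal_ne_zero]; positivity
    have h4 : ∑ ζ, conj (ψ' ζ) * ψ ζ = if ψ = ψ' then (Fintype.card (B b) : ℂ) else 0 := by
      simp only [h1, AddChar.sum_eq_ite, sub_eq_zero]
    rw [h2] at h4
    have h5 := Complex.conj_ofReal (√(Fintype.card (B b)))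
    generalize ((√(Fintype.card (B b)) : ℝ) : ℂ) = N at *
    simp only [map_inv₀, h5, Complex.conj_conj, Sigma.mk.injEq, true_and, heq_eq_eq,
      mul_ite, mul_one, mul_zero, Finset.mem_univ, if_true,
      Finset.sum_ite_eq', mul_left_comm _ N⁻¹, ← Finset.mul_sum]
    simp only [h4]
    split_ifs
    · field_simp
    · simp
  · have h : ∀ (ζ : B b) (ζ' : B b'), (⟨b, ζ⟩ : Σ b, B b) ≠ ⟨b', ζ'⟩ := fun ζ ζ' h =>
      hb (congrArg Sigma.fst h)
    simp [h, hb]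

omit [CompleteSpace H] in
-- Fourier inversion on a finite group, from the orthogonality relation summed over characters. It
-- shows that the transformed vectors span as much as the original basis.
theorem HilbertBasis.sum_smul_blockFourierVec (e : HilbertBasis (Σ b, B b) ℂ H) (b : β) (ζ : B b) :
    ((√(Fintype.card (B b)) : ℝ) : ℂ)⁻¹ • ∑ ψ : AddChar (B b) ℂ,
      ψ ζ • e.blockFourierVec ⟨b, ψ⟩ = e ⟨b, ζ⟩ := by
  classical
  have hcard : (0 : ℝ) < Fintype.card (B b) := by exact_mod_cast Fintype.card_pos
  have h2 : (Fintype.card (B b) : ℂ) = ((√(Fintype.card (B b)) : ℝ) : ℂ) ^ 2 := by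
    rw [← Complex.ofReal_pow, Real.sq_sqrt hcard.le, Complex.ofReal_natCast]
  have h3 : ((√(Fintype.card (B b)) : ℝ) : ℂ) ≠ 0 := by
    rw [Complex.ofReal_ne_zero]; positivity
  have h1 : ∀ (a : ℂ) (ψ : AddChar (B b) ℂ) (η : B b),
      a * (ψ ζ * (a * conj (ψ η))) = a * (a * ψ (ζ - η)) := fun a ψ η => by
    rw [mul_left_comm (ψ ζ), AddChar.map_sub_eq_div, div_eq_mul_inv, ← AddChar.map_neg_eq_inv, AddChar.map_neg_eq_conj]
  simp only [blockFourierVec, Finset.smul_sum, smul_smul, h1]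
  change ∑ ψ : AddChar (B b) ℂ, ∑ η : B b, _ = _
  rw [Finset.sum_comm]
  simp only [← Finset.sum_smul, ← Finset.mul_sum, AddChar.sum_apply_eq_ite, sub_eq_zero]
  rw [h2]
  generalize ((√(Fintype.card (B b)) : ℝ) : ℂ) = N at *
  simp only [mul_ite, mul_zero, ite_smul, zero_smul, Finset.sum_ite_eq, Finset.mem_univ, if_true]
  rw [show N⁻¹ * (N⁻¹ * N ^ 2) = 1 by field_simp, one_smul]

/-- The Hilbert basis given by the block discrete Fourier transform. -/
noncomputable def HilbertBasis.blockFourier (e : HilbertBasis (Σ b, B b) ℂ H) :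
    HilbertBasis (Σ b, AddChar (B b) ℂ) ℂ H :=
  HilbertBasis.mk e.orthonormal_blockFourierVec (by
    rw [← e.dense_span]
    refine Submodule.topologicalClosure_mono (Submodule.span_le.2 ?_)
    rintro _ ⟨⟨b, ζ⟩, rfl⟩
    rw [← e.sum_smul_blockFourierVec]
    refine Submodule.smul_mem _ _ (Submodule.sum_mem _ fun ψ _ => Submodule.smul_mem _ _ ?_)
    exact Submodule.subset_span ⟨_, rfl⟩)

theorem HilbertBasis.blockFourier_apply (e : HilbertBasis (Σ b, B b) ℂ H)
    (i : Σ b, AddChar (B b) ℂ) : e.blockFourier i = e.blockFourierVec i := by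
  rw [blockFourier, HilbertBasis.coe_mk]

/-- Block convolution operators are the operators that the block Fourier transform
diagonalises. -/
theorem HilbertBasis.forall_blockFourier_apply_iff (e : HilbertBasis (Σ b, B b) ℂ H)
    (T : H →L[ℂ] H) (c : ∀ b, B b → ℂ) :
    (∀ i, T (e.blockFourier i) = (∑ θ, c i.1 θ * i.2 θ) • e.blockFourier i) ↔
      ∀ b (ζ : B b), T (e ⟨b, ζ⟩) = ∑ θ, c b θ • e ⟨b, ζ + θ⟩ := by
  simp only [e.blockFourier_apply]
  constructor
  · intro h b ζ
    simp only [← e.sum_smul_blockFourierVec b, map_smul, map_sum, h, AddChar.map_add_eq_mul,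
      Finset.smul_sum, Finset.sum_smul, smul_smul]
    rw [Finset.sum_comm]
    refine Finset.sum_congr rfl fun θ _ => Finset.sum_congr rfl fun ψ _ => ?_
    congr 1
    ring
  · rintro h ⟨b, ψ⟩
    simp only [blockFourierVec, map_smul, map_sum, h]
    rw [smul_comm]
    congr 1
    rw [Finset.sum_smul]
    simp only [Finset.smul_sum, smul_smul]
    rw [Finset.sum_comm]
    refine Finset.sum_congr rfl fun θ _ => ?_
    -- The substitution `ζ ↦ ζ + θ` turns a shift by `θ` into multiplication by `ψ θ`.
    refine Fintype.sum_equiv (Equiv.addRight θ) _ _ fun ζ => ?_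
    simp only [Equiv.coe_addRight]
    congr 1
    have h1 : ψ θ * conj (ψ θ) = 1 := by
      rw [Complex.mul_conj, Complex.normSq_eq_norm_sq, AddChar.norm_apply]; simp
    rw [AddChar.map_add_eq_mul, map_mul]
    linear_combination (-(conj (ψ ζ) * c b θ)) * h1

end BlockFourier

/-! ### The group `ℚ_p / ℤ_p`: its standard character and its norm. -/

section Prufer

variable {p : ℕ} [Fact p.Prime]

theorem PadicInt.norm_sub_appr_div_le (y : ℤ_[p]) (n : ℕ) :
    ‖(y : ℚ_[p]) / (p : ℚ_[p]) ^ n - (PadicInt.appr y n : ℚ_[p]) / (p : ℚ_[p]) ^ n‖ ≤ 1 := by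
  have h := (PadicInt.norm_le_pow_iff_mem_span_pow _ n).2 (PadicInt.appr_spec n y)
  have hp : (0 : ℝ) < p := by exact_mod_cast (Fact.out : p.Prime).pos
  rw [← sub_div, norm_div, norm_pow, Padic.norm_p, div_le_one (by positivity)]
  have h2 : ‖(y : ℚ_[p]) - (PadicInt.appr y n : ℚ_[p])‖ = ‖y - (PadicInt.appr y n : ℤ_[p])‖ := by
    rw [PadicInt.norm_def, PadicInt.coe_sub, PadicInt.coe_natCast]
  rw [h2, inv_pow, ← zpow_natCast, ← zpow_neg]
  exact h

/-- The fractional part is a fraction whose denominator is a power of `p`, and it differs from the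
argument by a `p`-adic integer. -/
theorem padicFract_spec (x : ℚ_[p]) :
    ∃ a n : ℕ, padicFract p x = (a : ℝ) / (p : ℝ) ^ n ∧
      ‖x - (a : ℚ_[p]) / (p : ℚ_[p]) ^ n‖ ≤ 1 := by
  refine ⟨_, _, rfl, ?_⟩
  have h := PadicInt.norm_sub_appr_div_le
    (⟨x * (p : ℚ_[p]) ^ (-x.valuation).toNat, padic_norm_mul_pow_le_one p x⟩ : ℤ_[p])
    (-x.valuation).toNat
  have hp : (p : ℚ_[p]) ≠ 0 := by exact_mod_cast (Fact.out : p.Prime).ne_zero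
  rwa [mul_div_cancel_right₀ _ (pow_ne_zero _ hp)] at h

/-- A fraction whose denominator is a power of `p` is an integer if it is a `p`-adic integer. -/
theorem exists_int_of_padicNorm_le_one {a : ℤ} {n : ℕ}
    (h : ‖(a : ℚ_[p]) / (p : ℚ_[p]) ^ n‖ ≤ 1) : ∃ z : ℤ, (a : ℝ) / (p : ℝ) ^ n = z := by
  have hp : (0 : ℝ) < p := by exact_mod_cast (Fact.out : p.Prime).pos
  rw [norm_div, norm_pow, Padic.norm_p, div_le_one (by positivity), inv_pow, ← zpow_natCast,
    ← zpow_neg, Padic.norm_int_le_pow_iff_dvd] at h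
  obtain ⟨z, rfl⟩ := h
  refine ⟨z, ?_⟩
  push_cast
  field_simp

/-- The defect `{x + y} - {x} - {y}` is a fraction with denominator a power of `p`, and modulo `ℤ_p`
it equals `(x + y) - x - y = 0`. Such a fraction which is a `p`-adic integer is an integer. -/
theorem padicFract_add (x y : ℚ_[p]) :
    ∃ z : ℤ, padicFract p (x + y) = padicFract p x + padicFract p y + z := by
  obtain ⟨a, n, ha, ha'⟩ := padicFract_spec x
  obtain ⟨b, m, hb, hb'⟩ := padicFract_spec y
  obtain ⟨c, k, hc, hc'⟩ := padicFract_spec (x + y)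
  have hp : (p : ℚ_[p]) ≠ 0 := by exact_mod_cast (Fact.out : p.Prime).ne_zero
  have hpr : (p : ℝ) ≠ 0 := by exact_mod_cast (Fact.out : p.Prime).ne_zero
  have h : ‖((c * p ^ n * p ^ m - a * p ^ m * p ^ k - b * p ^ n * p ^ k : ℤ) : ℚ_[p])
      / (p : ℚ_[p]) ^ (n + m + k)‖ ≤ 1 := by
    have h1 : ((c * p ^ n * p ^ m - a * p ^ m * p ^ k - b * p ^ n * p ^ k : ℤ) : ℚ_[p])
        / (p : ℚ_[p]) ^ (n + m + k)
        = (x - (a : ℚ_[p]) / (p : ℚ_[p]) ^ n) + (y - (b : ℚ_[p]) / (p : ℚ_[p]) ^ m)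
          + -((x + y) - (c : ℚ_[p]) / (p : ℚ_[p]) ^ k) := by
      push_cast
      field_simp
      ring
    rw [h1]
    refine (Padic.nonarchimedean _ _).trans (max_le ((Padic.nonarchimedean _ _).trans
      (max_le ha' hb')) ?_)
    rwa [norm_neg]
  obtain ⟨z, hz⟩ := exists_int_of_padicNorm_le_one h
  refine ⟨z, ?_⟩
  rw [ha, hb, hc, ← hz]
  push_cast
  field_simp
  ring

theorem padicFract_eq_int_iff (x : ℚ_[p]) : (∃ z : ℤ, padicFract p x = z) ↔ ‖x‖ ≤ 1 := by
  constructor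
  · rintro ⟨z, hz⟩
    obtain ⟨a, n, ha, ha'⟩ := padicFract_spec x
    have hpr : (p : ℝ) ≠ 0 := by exact_mod_cast (Fact.out : p.Prime).ne_zero
    have hp : (p : ℚ_[p]) ≠ 0 := by exact_mod_cast (Fact.out : p.Prime).ne_zero
    rw [ha, div_eq_iff (pow_ne_zero _ hpr)] at hz
    have h1 : (a : ℤ) = z * p ^ n := by exact_mod_cast hz
    have h2 : (a : ℚ_[p]) / (p : ℚ_[p]) ^ n = z := by
      rw [div_eq_iff (pow_ne_zero _ hp)]
      exact_mod_cast congrArg (Int.cast : ℤ → ℚ_[p]) h1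
    rw [h2] at ha'
    rw [← sub_add_cancel x (z : ℚ_[p])]
    exact (Padic.nonarchimedean _ _).trans (max_le ha' (Padic.norm_int_le_one z))
  · intro h
    exact ⟨0, by rw [padicFract_eq_zero p h, Int.cast_zero]⟩

theorem pruferGroup_mk_eq_zero_iff (x : ℚ_[p]) :
    (Submodule.Quotient.mk x : PruferGroup p) = 0 ↔ ‖x‖ ≤ 1 := by
  rw [Submodule.Quotient.mk_eq_zero, Submodule.mem_one]
  exact ⟨by rintro ⟨y, rfl⟩; exact y.2, fun h => ⟨⟨x, h⟩, rfl⟩⟩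

/-- The character `t ↦ exp (2 π i {t}_p)` of `ℚ_p / ℤ_p`. -/
noncomputable def pruferChar (p : ℕ) [Fact p.Prime] (t : PruferGroup p) : ℂ :=
  Complex.exp (2 * Real.pi * Complex.I * (pruferFract p t : ℂ))

theorem pruferChar_add (s t : PruferGroup p) :
    pruferChar p (s + t) = pruferChar p s * pruferChar p t := by
  obtain ⟨x, rfl⟩ := Submodule.Quotient.mk_surjective _ s
  obtain ⟨y, rfl⟩ := Submodule.Quotient.mk_surjective _ t
  obtain ⟨z, hz⟩ := padicFract_add x y
  have h : ∀ x : ℚ_[p], pruferFract p (Submodule.Quotient.mk x) = padicFract p x := fun _ => rfl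
  rw [← Submodule.Quotient.mk_add]
  simp only [pruferChar, h, hz]
  push_cast
  rw [mul_add, mul_add, Complex.exp_add, Complex.exp_add,
    show 2 * (Real.pi : ℂ) * Complex.I * z = z * (2 * Real.pi * Complex.I) by ring,
    Complex.exp_int_mul_two_pi_mul_I, mul_one]

theorem norm_pruferChar (t : PruferGroup p) : ‖pruferChar p t‖ = 1 := by
  rw [pruferChar, show 2 * (Real.pi : ℂ) * Complex.I * (pruferFract p t : ℂ)
    = ((2 * Real.pi * pruferFract p t : ℝ) : ℂ) * Complex.I by push_cast; ring]
  exact Complex.norm_exp_ofReal_mul_I _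

/-- Faithfulness of the standard character. Both the orthogonality of the characters and the
separation of points rest on it. -/
theorem pruferChar_eq_one_iff (t : PruferGroup p) : pruferChar p t = 1 ↔ t = 0 := by
  obtain ⟨x, rfl⟩ := Submodule.Quotient.mk_surjective _ t
  rw [pruferGroup_mk_eq_zero_iff, ← padicFract_eq_int_iff, pruferChar, Complex.exp_eq_one_iff]
  refine exists_congr fun z => ?_
  change 2 * (Real.pi : ℂ) * Complex.I * (padicFract p x : ℂ) = _ ↔ _
  rw [mul_comm, mul_left_inj' Complex.two_pi_I_ne_zero]
  norm_cast

/-- Representatives of a class differ by elements of norm at most one, which by the ultrametric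
inequality cannot change a norm greater than one; the infimum in the quotient norm is therefore
constant. -/
theorem norm_pruferGroup_mk (x : ℚ_[p]) (hx : 1 < ‖x‖) :
    ‖(Submodule.Quotient.mk x : PruferGroup p)‖ = ‖x‖ := by
  refine le_antisymm (Submodule.Quotient.norm_mk_le _ x) ?_
  by_contra! hlt
  obtain ⟨m, hm, hm'⟩ := Submodule.Quotient.norm_mk_lt (S := (1 : Submodule ℤ_[p] ℚ_[p]))
    (Submodule.Quotient.mk x) (sub_pos.2 hlt)
  rw [add_sub_cancel] at hm'
  rw [← sub_eq_zero, ← Submodule.Quotient.mk_sub, pruferGroup_mk_eq_zero_iff] at hm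
  have := Padic.nonarchimedean m (-(m - x))
  rw [norm_neg, neg_sub, add_sub_cancel] at this
  rcases le_max_iff.1 this with h | h
  · linarith
  · linarith

theorem one_lt_norm_pruferGroup {t : PruferGroup p} (ht : t ≠ 0) : 1 < ‖t‖ := by
  obtain ⟨x, rfl⟩ := Submodule.Quotient.mk_surjective _ t
  rw [Ne, pruferGroup_mk_eq_zero_iff, not_le] at ht
  rwa [norm_pruferGroup_mk x ht]

theorem norm_add_le_max_pruferGroup (s t : PruferGroup p) : ‖s + t‖ ≤ max ‖s‖ ‖t‖ := by
  obtain ⟨x, rfl⟩ := Submodule.Quotient.mk_surjective _ s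
  obtain ⟨y, rfl⟩ := Submodule.Quotient.mk_surjective _ t
  by_cases hx : ‖x‖ ≤ 1
  · rw [(pruferGroup_mk_eq_zero_iff x).2 hx, zero_add]; exact le_max_right _ _
  by_cases hy : ‖y‖ ≤ 1
  · rw [(pruferGroup_mk_eq_zero_iff y).2 hy, add_zero]; exact le_max_left _ _
  rw [norm_pruferGroup_mk x (not_le.1 hx), norm_pruferGroup_mk y (not_le.1 hy),
    ← Submodule.Quotient.mk_add]
  exact (Submodule.Quotient.norm_mk_le _ _).trans (Padic.nonarchimedean x y)

theorem exists_max_one_norm_pruferGroup_eq (t : PruferGroup p) :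
    ∃ n : ℕ, max 1 ‖t‖ = (p : ℝ) ^ n := by
  obtain ⟨x, rfl⟩ := Submodule.Quotient.mk_surjective _ t
  by_cases hx : ‖x‖ ≤ 1
  · exact ⟨0, by rw [(pruferGroup_mk_eq_zero_iff x).2 hx]; simp⟩
  · rw [not_le] at hx
    rw [norm_pruferGroup_mk x hx, max_eq_right hx.le]
    have hx0 : x ≠ 0 := by rintro rfl; simp at hx; linarith
    have hp : (1 : ℝ) < p := by exact_mod_cast (Fact.out : p.Prime).one_lt
    rw [Padic.norm_eq_zpow_neg_valuation hx0] at hx ⊢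
    have h1 := (one_lt_zpow_iff_right₀ hp).1 hx
    exact ⟨(-x.valuation).toNat, by rw [← zpow_natCast, Int.toNat_of_nonneg h1.le]⟩

theorem exists_natCast_div_pow_eq {t : PruferGroup p} {n : ℕ} (ht : ‖t‖ ≤ (p : ℝ) ^ n) :
    ∃ a : Fin (p ^ n), (Submodule.Quotient.mk ((a : ℕ) / (p : ℚ_[p]) ^ n) : PruferGroup p) = t := by
  obtain ⟨x, rfl⟩ := Submodule.Quotient.mk_surjective _ t
  have hp : (1 : ℝ) < p := by exact_mod_cast (Fact.out : p.Prime).one_lt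
  have hp0 : (p : ℚ_[p]) ≠ 0 := by exact_mod_cast (Fact.out : p.Prime).ne_zero
  have hx : ‖x‖ ≤ (p : ℝ) ^ n := by
    by_cases hx : ‖x‖ ≤ 1
    · exact hx.trans (one_le_pow₀ hp.le)
    · rwa [norm_pruferGroup_mk x (not_le.1 hx)] at ht
  have hy : ‖x * (p : ℚ_[p]) ^ n‖ ≤ 1 := by
    rw [norm_mul, norm_pow, Padic.norm_p, inv_pow, ← div_eq_mul_inv]
    exact div_le_one_of_le₀ hx (by positivity)
  refine ⟨⟨PadicInt.appr ⟨_, hy⟩ n, PadicInt.appr_lt _ _⟩, ?_⟩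
  rw [← sub_eq_zero, ← Submodule.Quotient.mk_sub, pruferGroup_mk_eq_zero_iff, norm_sub_rev]
  have h := PadicInt.norm_sub_appr_div_le ⟨_, hy⟩ n
  rwa [mul_div_cancel_right₀ _ (pow_ne_zero _ hp0)] at h

end Prufer

/-! ### Weights and counting in the dual group. -/

section Dual

variable {p : ℕ} [Fact p.Prime] {d : ℕ}

theorem norm_add_le_max_zpDual (ξ η : ZpDual p d) : ‖ξ + η‖ ≤ max ‖ξ‖ ‖η‖ := by
  refine (pi_norm_le_iff_of_nonneg (le_max_of_le_left (norm_nonneg _))).2 fun i => ?_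
  exact (norm_add_le_max_pruferGroup _ _).trans
    (max_le_max (norm_le_pi_norm ξ i) (norm_le_pi_norm η i))

theorem one_lt_norm_zpDual {ξ : ZpDual p d} (hξ : ξ ≠ 0) : 1 < ‖ξ‖ := by
  obtain ⟨i, hi⟩ := Function.ne_iff.1 hξ
  exact (one_lt_norm_pruferGroup hi).trans_le (norm_le_pi_norm ξ i)

theorem one_le_zpWeight (ξ : ZpDual p d) : 1 ≤ zpWeight ξ := le_max_left _ _

theorem zpWeight_pos (ξ : ZpDual p d) : 0 < zpWeight ξ := one_pos.trans_le (one_le_zpWeight ξ)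

theorem norm_le_zpWeight (ξ : ZpDual p d) : ‖ξ‖ ≤ zpWeight ξ := le_max_right _ _

theorem exists_zpWeight_eq_pow (ξ : ZpDual p d) : ∃ n : ℕ, zpWeight ξ = (p : ℝ) ^ n := by
  by_cases h : ∃ i, ‖ξ‖ = ‖ξ i‖
  · obtain ⟨i, hi⟩ := h
    rw [zpWeight, hi]
    exact exists_max_one_norm_pruferGroup_eq _
  -- The maximum norm is attained at a coordinate unless `d = 0`, where the only frequency has
  -- weight one.
  · refine ⟨0, ?_⟩
    rcases isEmpty_or_nonempty (Fin d) with h0 | h0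
    · rw [zpWeight, Subsingleton.elim ξ 0]; simp
    · obtain ⟨i, hi⟩ := Finite.exists_max fun i => ‖ξ i‖
      exact absurd ⟨i, le_antisymm ((pi_norm_le_iff_of_nonneg (norm_nonneg _)).2 hi)
        (norm_le_pi_norm ξ i)⟩ h

/-- The exponent `d + 1` makes the weights summable. -/
theorem summable_zpWeight_inv_pow (p : ℕ) [Fact p.Prime] (d : ℕ) :
    Summable fun ξ : ZpDual p d => (zpWeight ξ ^ (d + 1))⁻¹ := by
  have hp : (1 : ℝ) < p := by exact_mod_cast (Fact.out : p.Prime).one_lt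
  -- A frequency of weight `p ^ n` is determined by `d` numerators below `p ^ n`. So there are at
  -- most `p ^ (n d)` of them, each contributing `p ^ (-n (d + 1))`, and a geometric series of ratio
  -- `1 / p` remains.
  have hex : ∀ ξ : ZpDual p d, ∃ s : Σ n : ℕ, (Fin d → Fin (p ^ n)),
      zpWeight ξ = (p : ℝ) ^ s.1 ∧
      ∀ i, (Submodule.Quotient.mk ((s.2 i : ℕ) / (p : ℚ_[p]) ^ s.1) : PruferGroup p) = ξ i := by
    intro ξ
    obtain ⟨n, hn⟩ := exists_zpWeight_eq_pow ξ
    choose a ha using fun i => exists_natCast_div_pow_eq (n := n) (t := ξ i)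
      (hn ▸ (norm_le_pi_norm ξ i).trans (norm_le_zpWeight ξ))
    exact ⟨⟨n, a⟩, hn, ha⟩
  choose s hs hs' using hex
  have hinj : Function.Injective s := fun ξ ξ' h => funext fun i => by
    rw [← hs' ξ i, ← hs' ξ' i, h]
  have hsum : Summable fun t : Σ n : ℕ, (Fin d → Fin (p ^ n)) => (((p : ℝ) ^ t.1) ^ (d + 1))⁻¹ := by
    rw [summable_sigma_of_nonneg fun t => by positivity]
    refine ⟨fun n => Summable.of_finite, ?_⟩
    simp only [tsum_fintype, Finset.sum_const, Finset.card_univ, Fintype.card_fun,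
      Fintype.card_fin, nsmul_eq_mul]
    refine (summable_geometric_of_lt_one (r := (p : ℝ)⁻¹) (by positivity)
      (inv_lt_one_of_one_lt₀ hp)).congr fun n => ?_
    push_cast
    rw [inv_pow, pow_succ ((p : ℝ) ^ n), mul_inv, ← mul_assoc, mul_inv_cancel₀ (by positivity),
      one_mul]
  refine (hsum.comp_injective hinj).congr fun ξ => ?_
  simp only [Function.comp, hs]

instance countable_zpDual (p : ℕ) [Fact p.Prime] (d : ℕ) : Countable (ZpDual p d) := by
  rw [← Set.countable_univ_iff]
  refine (summable_zpWeight_inv_pow p d).countable_support.mono fun ξ _ => ?_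
  exact inv_ne_zero (pow_ne_zero _ (zpWeight_pos ξ).ne')

theorem finite_norm_le_zpDual (p : ℕ) [Fact p.Prime] (d : ℕ) (R : ℝ) :
    {ξ : ZpDual p d | ‖ξ‖ ≤ R}.Finite := by
  set M := max 1 R with hM
  have hM1 : 1 ≤ M := le_max_left _ _
  have h := (summable_zpWeight_inv_pow p d).tendsto_cofinite_zero.eventually_lt_const
    (u := (M ^ (d + 1))⁻¹) (by positivity)
  rw [Filter.eventually_cofinite] at h
  refine h.subset fun ξ hξ => ?_
  rw [Set.mem_ofPred_eq, not_lt]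
  have h1 : zpWeight ξ ≤ M := max_le_max le_rfl hξ
  have h2 := zpWeight_pos ξ
  gcongr

end Dual

/-! ### Fourier analysis on `ℤ_p^d`. -/

section Characters

open Filter Topology

variable {p : ℕ} [Fact p.Prime] {d : ℕ}

theorem zpPairing_add_left (ξ η : ZpDual p d) (x : ZpPow p d) :
    zpPairing (ξ + η) x = zpPairing ξ x + zpPairing η x := by
  simp [zpPairing, smul_add, Finset.sum_add_distrib]

theorem zpPairing_add_right (ξ : ZpDual p d) (x y : ZpPow p d) :
    zpPairing ξ (x + y) = zpPairing ξ x + zpPairing ξ y := by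
  simp [zpPairing, add_smul, Finset.sum_add_distrib]

theorem zpPairing_single (ξ : ZpDual p d) (i : Fin d) (z : ℤ_[p]) :
    zpPairing ξ (Pi.single i z) = z • ξ i := by
  rw [zpPairing, Finset.sum_eq_single i]
  · simp
  · intro j _ hj
    rw [Pi.single_eq_of_ne hj, zero_smul]
  · simp

theorem single_zpPairing (t : PruferGroup p) (i : Fin d) (x : ZpPow p d) :
    zpPairing (Pi.single i t) x = x i • t := by
  rw [zpPairing, Finset.sum_eq_single i]
  · simp
  · intro j _ hj
    rw [Pi.single_eq_of_ne hj, smul_zero]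
  · simp

theorem zpChar_eq (ξ : ZpDual p d) (x : ZpPow p d) : zpChar ξ x = pruferChar p (zpPairing ξ x) :=
  rfl

theorem zpChar_add_left (ξ η : ZpDual p d) (x : ZpPow p d) :
    zpChar (ξ + η) x = zpChar ξ x * zpChar η x := by
  simp only [zpChar_eq, zpPairing_add_left, pruferChar_add]

theorem zpChar_add_right (ξ : ZpDual p d) (x y : ZpPow p d) :
    zpChar ξ (x + y) = zpChar ξ x * zpChar ξ y := by
  simp only [zpChar_eq, zpPairing_add_right, pruferChar_add]

theorem norm_zpChar (ξ : ZpDual p d) (x : ZpPow p d) : ‖zpChar ξ x‖ = 1 := norm_pruferChar _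

theorem zpChar_zero_left (x : ZpPow p d) : zpChar (0 : ZpDual p d) x = 1 := by
  rw [zpChar_eq, pruferChar_eq_one_iff]
  simp [zpPairing]

theorem zpChar_mul_conj (ξ : ZpDual p d) (x : ZpPow p d) : zpChar ξ x * conj (zpChar ξ x) = 1 := by
  rw [Complex.mul_conj, Complex.normSq_eq_norm_sq, norm_zpChar]; simp

theorem conj_zpChar (ξ : ZpDual p d) (x : ZpPow p d) : conj (zpChar ξ x) = zpChar (-ξ) x := by
  have h1 : zpChar ξ x * zpChar (-ξ) x = 1 := by
    rw [← zpChar_add_left, add_neg_cancel, zpChar_zero_left]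
  have h2 : zpChar ξ x ≠ 0 := by rw [← norm_ne_zero_iff, norm_zpChar]; exact one_ne_zero
  exact mul_left_cancel₀ h2 ((zpChar_mul_conj ξ x).trans h1.symm)

instance zpHaar_isAddLeftInvariant (p : ℕ) [Fact p.Prime] (d : ℕ) :
    (zpHaar p d).IsAddLeftInvariant :=
  inferInstanceAs (Measure.addHaarMeasure (⊤ : TopologicalSpace.PositiveCompacts
    (ZpPow p d))).IsAddLeftInvariant

instance zpHaar_regular (p : ℕ) [Fact p.Prime] (d : ℕ) : (zpHaar p d).Regular :=
  inferInstanceAs (Measure.addHaarMeasure (⊤ : TopologicalSpace.PositiveCompacts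
    (ZpPow p d))).Regular

theorem integral_zpChar (ξ : ZpDual p d) [Decidable (ξ = 0)] :
    ∫ x, zpChar ξ x ∂(zpHaar p d) = if ξ = 0 then 1 else 0 := by
  split_ifs with h
  · subst h
    simp [zpChar_zero_left]
  · obtain ⟨i, hi⟩ := Function.ne_iff.1 h
    have h1 : zpChar ξ (Pi.single i 1) ≠ 1 := by
      rw [zpChar_eq, Ne, pruferChar_eq_one_iff, zpPairing_single, one_smul]
      exact hi
    -- Translation by a point where the character is not `1` multiplies the integral by a factor
    -- other than `1`.
    have h2 := integral_add_left_eq_self (μ := zpHaar p d) (zpChar ξ) (Pi.single i 1)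
    simp only [zpChar_add_right, integral_const_mul] at h2
    have h3 : (zpChar ξ (Pi.single i 1) - 1) * ∫ x, zpChar ξ x ∂(zpHaar p d) = 0 := by
      rw [sub_mul, h2, one_mul, sub_self]
    exact (mul_eq_zero.1 h3).resolve_left (sub_ne_zero.2 h1)

theorem zpFourier_zpChar (ξ η : ZpDual p d) [Decidable (η = ξ)] :
    zpFourier (zpChar η) ξ = if η = ξ then 1 else 0 := by
  classical
  simp only [zpFourier, conj_zpChar, ← zpChar_add_left, ← sub_eq_add_neg]
  rw [integral_zpChar]
  simp only [sub_eq_zero]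

/-- The star subalgebra of `C(ℤ_p^d, ℂ)` generated by the characters. -/
noncomputable def zpCharSubalgebra (p : ℕ) [Fact p.Prime] (d : ℕ) : StarSubalgebra ℂ C(ZpPow p d, ℂ) where
  toSubalgebra := Algebra.adjoin ℂ (Set.range zpCharC)
  star_mem' := by
    change Algebra.adjoin ℂ (Set.range zpCharC) ≤ star (Algebra.adjoin ℂ (Set.range zpCharC))
    refine Algebra.adjoin_le ?_
    rintro - ⟨ξ, rfl⟩
    exact Algebra.subset_adjoin ⟨-ξ, ContinuousMap.ext fun x => (conj_zpChar ξ x).symm⟩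

/-- Products of characters are characters, so their span is already an algebra, and
Stone–Weierstrass applies to it. -/
theorem zpCharSubalgebra_toSubmodule (p : ℕ) [Fact p.Prime] (d : ℕ) :
    Subalgebra.toSubmodule (zpCharSubalgebra p d).toSubalgebra = trigPoly p d := by
  apply Algebra.adjoin_eq_span_of_subset
  refine Set.Subset.trans ?_ Submodule.subset_span
  intro f hf
  refine Submonoid.closure_induction (fun _ => id) ⟨0, ?_⟩ ?_ hf
  · ext1 x; exact zpChar_zero_left x
  · rintro - - - - ⟨ξ, rfl⟩ ⟨η, rfl⟩
    refine ⟨ξ + η, ?_⟩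
    ext1 x
    exact zpChar_add_left ξ η x

theorem zpCharSubalgebra_separatesPoints (p : ℕ) [Fact p.Prime] (d : ℕ) :
    (zpCharSubalgebra p d).SeparatesPoints := by
  intro x y hxy
  obtain ⟨i, hi⟩ := Function.ne_iff.1 hxy
  have hz : ((x i - y i : ℤ_[p]) : ℚ_[p]) ≠ 0 := by
    rw [Ne, PadicInt.coe_eq_zero]
    exact sub_ne_zero.2 hi
  have hp0 : (p : ℚ_[p]) ≠ 0 := by exact_mod_cast (Fact.out : p.Prime).ne_zero
  have hp : (1 : ℝ) < p := by exact_mod_cast (Fact.out : p.Prime).one_lt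
  -- With this choice `(x i - y i) • t` is the class of `1 / p`, which is not zero.
  set t : PruferGroup p := Submodule.Quotient.mk ((p * (x i - y i : ℤ_[p]) : ℚ_[p])⁻¹)
  have ht : (x i - y i) • t ≠ 0 := by
    change (Submodule.Quotient.mk ((x i - y i) • (p * (x i - y i : ℤ_[p]) : ℚ_[p])⁻¹) :
      PruferGroup p) ≠ 0
    rw [Ne, pruferGroup_mk_eq_zero_iff, Algebra.smul_def]
    change ¬ ‖((x i - y i : ℤ_[p]) : ℚ_[p]) * (p * (x i - y i : ℤ_[p]) : ℚ_[p])⁻¹‖ ≤ 1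
    rw [mul_inv, mul_left_comm, mul_inv_cancel₀ hz, mul_one, norm_inv, Padic.norm_p, inv_inv]
    exact not_le.2 hp
  refine ⟨_, ⟨zpCharC (Pi.single i t), Algebra.subset_adjoin ⟨_, rfl⟩, rfl⟩, ?_⟩
  intro h
  change zpChar (Pi.single i t) x = zpChar (Pi.single i t) y at h
  have h2 : zpChar (Pi.single i t) (x - y) = 1 := by
    have h3 : zpChar (Pi.single i t) y ≠ 0 := by
      rw [← norm_ne_zero_iff, norm_zpChar]; exact one_ne_zero
    rw [← mul_left_inj' h3, ← zpChar_add_right, sub_add_cancel, h, one_mul]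
  rw [zpChar_eq, pruferChar_eq_one_iff, single_zpPairing] at h2
  exact ht h2

theorem trigPoly_topologicalClosure (p : ℕ) [Fact p.Prime] (d : ℕ) :
    (trigPoly p d).topologicalClosure = ⊤ := by
  rw [← zpCharSubalgebra_toSubmodule]
  exact congr_arg (Subalgebra.toSubmodule <| StarSubalgebra.toSubalgebra ·)
    (ContinuousMap.starSubalgebra_topologicalClosure_eq_top_of_separatesPoints _
      (zpCharSubalgebra_separatesPoints p d))

/-- The character with frequency `ξ` as an element of `L²(ℤ_p^d)`. -/
noncomputable abbrev zpCharL2 (ξ : ZpDual p d) : ZpL2 p d :=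
  ContinuousMap.toLp 2 (zpHaar p d) ℂ (zpCharC ξ)

theorem coeFn_zpCharL2 (ξ : ZpDual p d) : (zpCharL2 ξ : ZpPow p d → ℂ) =ᵐ[zpHaar p d] zpChar ξ :=
  ContinuousMap.coeFn_toLp _ _

theorem orthonormal_zpCharL2 (p : ℕ) [Fact p.Prime] (d : ℕ) :
    Orthonormal ℂ (zpCharL2 : ZpDual p d → ZpL2 p d) := by
  classical
  rw [orthonormal_iff_ite]
  intro ξ η
  rw [ContinuousMap.inner_toLp]
  have h := zpFourier_zpChar ξ η
  rw [zpFourier] at h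
  simp only [eq_comm (a := ξ)]
  exact h

theorem span_zpCharL2_topologicalClosure (p : ℕ) [Fact p.Prime] (d : ℕ) :
    (Submodule.span ℂ (Set.range (zpCharL2 : ZpDual p d → ZpL2 p d))).topologicalClosure = ⊤ := by
  convert! (ContinuousMap.toLp_denseRange ℂ (zpHaar p d) ℂ
    (p := 2) (by simp)).topologicalClosure_map_submodule (trigPoly_topologicalClosure p d)
  rw [trigPoly, Submodule.map_span, ← Set.range_comp]
  rfl

/-- The Hilbert basis of characters of `L²(ℤ_p^d)`. -/
noncomputable def zpBasis (p : ℕ) [Fact p.Prime] (d : ℕ) :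
    HilbertBasis (ZpDual p d) ℂ (ZpL2 p d) :=
  HilbertBasis.mk (orthonormal_zpCharL2 p d) (span_zpCharL2_topologicalClosure p d).ge

theorem zpBasis_apply (ξ : ZpDual p d) : zpBasis p d ξ = zpCharL2 ξ := by
  rw [zpBasis, HilbertBasis.coe_mk]

theorem MeasureTheory.Integrable.mul_continuousMap {f : ZpPow p d → ℂ}
    (hf : Integrable f (zpHaar p d)) (g : C(ZpPow p d, ℂ)) :
    Integrable (fun x => f x * g x) (zpHaar p d) :=
  hf.mul_bdd (c := ‖g‖) g.continuous.aestronglyMeasurable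
    (Eventually.of_forall fun x => g.norm_coe_le_norm x)

/-- The functional `g ↦ ∫ f g` is continuous for the uniform norm and vanishes on the dense space of
trigonometric polynomials. -/
theorem integral_mul_continuousMap_eq_zero {f : ZpPow p d → ℂ} (hf : Integrable f (zpHaar p d))
    (h : ∀ ξ, zpFourier f ξ = 0) (g : C(ZpPow p d, ℂ)) : ∫ x, f x * g x ∂(zpHaar p d) = 0 := by
  let L : C(ZpPow p d, ℂ) →ₗ[ℂ] ℂ :=
    { toFun := fun g => ∫ x, f x * g x ∂(zpHaar p d)
      map_add' := fun g₁ g₂ => by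
        simp only [ContinuousMap.add_apply, mul_add]
        exact integral_add (hf.mul_continuousMap g₁) (hf.mul_continuousMap g₂)
      map_smul' := fun c g => by
        simp only [ContinuousMap.smul_apply, smul_eq_mul, mul_left_comm _ c, integral_const_mul,
          RingHom.id_apply] }
  have hL : ∀ g, ‖L g‖ ≤ (∫ x, ‖f x‖ ∂(zpHaar p d)) * ‖g‖ := fun g => by
    refine (norm_integral_le_integral_norm _).trans ?_
    rw [← integral_mul_const]
    refine integral_mono (hf.mul_continuousMap g).norm (hf.norm.mul_const _) fun x => ?_
    simp only [norm_mul]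
    gcongr
    exact g.norm_coe_le_norm x
  have hker : trigPoly p d ≤ LinearMap.ker (L.mkContinuous _ hL : C(ZpPow p d, ℂ) →ₗ[ℂ] ℂ) := by
    refine Submodule.span_le.2 ?_
    rintro _ ⟨ξ, rfl⟩
    change ∫ x, f x * zpChar ξ x ∂(zpHaar p d) = 0
    rw [← h (-ξ), zpFourier]
    simp only [conj_zpChar, neg_neg]
  have h1 := Submodule.topologicalClosure_minimal _ hker
    (ContinuousLinearMap.isClosed_ker (L.mkContinuous _ hL))
  rw [trigPoly_topologicalClosure] at h1
  exact h1 (Submodule.mem_top (x := g))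

/-- An integrable function is determined by its Fourier coefficients. -/
theorem ae_eq_zero_of_zpFourier_eq_zero {f : ZpPow p d → ℂ} (hf : Integrable f (zpHaar p d))
    (h : ∀ ξ, zpFourier f ξ = 0) : f =ᵐ[zpHaar p d] 0 := by
  -- Indicators of closed sets are pointwise limits of continuous functions with values in `[0, 1]`,
  -- so dominated convergence passes from continuous test functions to integrals over closed sets.
  refine ae_eq_zero_of_forall_setIntegral_isClosed_eq_zero hf fun F hF => ?_
  have h1 : Tendsto (fun n => ∫ x, f x * ((hF.apprSeq n x : ℝ) : ℂ) ∂(zpHaar p d)) atTop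
      (𝓝 (∫ x, F.indicator f x ∂(zpHaar p d))) := by
    refine tendsto_integral_of_dominated_convergence (fun x => ‖f x‖) (fun n => ?_) hf.norm
      (fun n => Eventually.of_forall fun x => ?_) (Eventually.of_forall fun x => ?_)
    · refine hf.aestronglyMeasurable.mul (Continuous.aestronglyMeasurable ?_)
      fun_prop
    · rw [norm_mul, Complex.norm_real, NNReal.norm_eq]
      refine mul_le_of_le_one_right (norm_nonneg _) ?_
      exact_mod_cast HasOuterApproxClosed.apprSeq_apply_le_one hF n x
    · have h2 := (tendsto_pi_nhds.1 (HasOuterApproxClosed.tendsto_apprSeq hF)) x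
      have h3 : Tendsto (fun n => f x * ((hF.apprSeq n x : ℝ) : ℂ)) atTop
          (𝓝 (f x * (((F.indicator (fun _ => (1 : NNReal)) x : NNReal) : ℝ) : ℂ))) :=
        (((Complex.continuous_ofReal.comp NNReal.continuous_coe).tendsto _).comp h2).const_mul _
      convert h3 using 2
      by_cases hx : x ∈ F <;> simp [hx]
  rw [integral_indicator hF.measurableSet] at h1
  refine tendsto_nhds_unique h1 (tendsto_const_nhds.congr fun n => ?_)
  exact (integral_mul_continuousMap_eq_zero hf h
    ⟨fun x => ((hF.apprSeq n x : ℝ) : ℂ), by fun_prop⟩).symm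

theorem norm_zpFourier_le {f : ZpPow p d → ℂ} (ξ : ZpDual p d) {C : ℝ} (hf : ∀ x, ‖f x‖ ≤ C) :
    ‖zpFourier f ξ‖ ≤ C := by
  refine (norm_integral_le_of_norm_le_const (C := C) (Eventually.of_forall fun x => ?_)).trans ?_
  · rw [norm_mul, RCLike.norm_conj, norm_zpChar, mul_one]
    exact hf x
  · simp

theorem zpFourier_sub {f g : ZpPow p d → ℂ} (hf : Integrable f (zpHaar p d))
    (hg : Integrable g (zpHaar p d)) (ξ : ZpDual p d) :
    zpFourier (fun x => f x - g x) ξ = zpFourier f ξ - zpFourier g ξ := by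
  simp only [zpFourier, sub_mul]
  have h : ∀ x, conj (zpChar ξ x) = zpCharC (-ξ) x := fun x => conj_zpChar ξ x
  simp only [h]
  exact integral_sub (hf.mul_continuousMap _) (hg.mul_continuousMap _)

/-- The Fourier coefficients of an absolutely convergent Fourier series. -/
theorem zpFourier_tsum {a : ZpDual p d → ℂ} (ha : Summable fun ζ => ‖a ζ‖) (ξ : ZpDual p d) :
    zpFourier (fun x => ∑' ζ, a ζ * zpChar ζ x) ξ = a ξ := by
  classical
  have h := hasSum_integral_of_summable_integral_norm (μ := zpHaar p d)
    (F := fun ζ x => a ζ * zpChar ζ x * conj (zpChar ξ x)) (fun ζ => ?_) ?_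
  · simp only [tsum_mul_right] at h
    rw [zpFourier, ← h.tsum_eq]
    have h2 : ∀ ζ, ∫ x, a ζ * zpChar ζ x * conj (zpChar ξ x) ∂(zpHaar p d)
        = if ζ = ξ then a ζ else 0 := fun ζ => by
      have h3 := zpFourier_zpChar ξ ζ
      rw [zpFourier] at h3
      simp only [mul_assoc, integral_const_mul, h3, mul_ite, mul_one, mul_zero]
    simp only [h2, tsum_ite_eq]
  · simp only [conj_zpChar, mul_assoc, ← zpChar_add_left]
    refine Integrable.const_mul ?_ _
    exact (continuous_zpChar _).integrable_of_hasCompactSupport (HasCompactSupport.of_compactSpace _)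
  · simpa [norm_zpChar] using ha

theorem continuous_tsum_zpChar {a : ZpDual p d → ℂ} (ha : Summable fun ζ => ‖a ζ‖) :
    Continuous fun x => ∑' ζ, a ζ * zpChar ζ x :=
  continuous_tsum (fun ζ => continuous_const.mul (continuous_zpChar ζ)) ha
    fun ζ x => by rw [norm_mul, norm_zpChar, mul_one]

/-- Fourier inversion for functions with absolutely convergent Fourier series. -/
theorem ae_eq_tsum_zpFourier {f : ZpPow p d → ℂ} (hf : Integrable f (zpHaar p d))
    (h : Summable fun ζ => ‖zpFourier f ζ‖) :
    f =ᵐ[zpHaar p d] fun x => ∑' ζ, zpFourier f ζ * zpChar ζ x := by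
  have hg : Integrable (fun x => ∑' ζ, zpFourier f ζ * zpChar ζ x) (zpHaar p d) :=
    (continuous_tsum_zpChar h).integrable_of_hasCompactSupport (HasCompactSupport.of_compactSpace _)
  have h1 := ae_eq_zero_of_zpFourier_eq_zero (hf.sub hg) fun ξ => by
    change zpFourier (fun x => f x - ∑' ζ, zpFourier f ζ * zpChar ζ x) ξ = 0
    rw [zpFourier_sub hf hg, zpFourier_tsum h, sub_self]
  filter_upwards [h1] with x hx
  exact sub_eq_zero.1 hx

end Characters

/-! ### Bounded extensions and the Hilbert–Schmidt criterion. -/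

section BoundedExtensions

open Filter Topology

variable {p : ℕ} [Fact p.Prime] {d : ℕ}

theorem zpL2_coeFn_sum_smul {ι : Type*} (s : Finset ι) (c : ι → ℂ) (v : ι → ZpL2 p d)
    (f : ι → ZpPow p d → ℂ) (h : ∀ i, (v i : ZpPow p d → ℂ) =ᵐ[zpHaar p d] f i) :
    ((∑ i ∈ s, c i • v i : ZpL2 p d) : ZpPow p d → ℂ)
      =ᵐ[zpHaar p d] fun x => ∑ i ∈ s, c i * f i x := by
  classical
  induction s using Finset.induction_on with
  | empty => simp only [Finset.sum_empty]; exact Lp.coeFn_zero ℂ 2 (zpHaar p d)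
  | insert a s ha ih =>
    rw [Finset.sum_insert ha]
    filter_upwards [Lp.coeFn_add (c a • v a) (∑ i ∈ s, c i • v i), Lp.coeFn_smul (c a) (v a), ih, h a]
      with x h1 h2 h3 h4
    rw [h1, Pi.add_apply, h2, Pi.smul_apply, h3, h4, Finset.sum_insert ha, smul_eq_mul]

theorem pseudoDiff_sum (σ : ZpPow p d → ZpDual p d → ℂ) (c : ZpDual p d →₀ ℂ) (x : ZpPow p d) :
    pseudoDiff σ (fun y => ∑ ξ ∈ c.support, c ξ * zpChar ξ y) x
      = ∑ ξ ∈ c.support, c ξ * (σ x ξ * zpChar ξ x) := by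
  have h0 : ∀ ξ ∉ c.support, c ξ = 0 := fun ξ h => Finsupp.notMem_support_iff.1 h
  have h1 : ∀ ξ, zpFourier (fun y => ∑ ξ ∈ c.support, c ξ * zpChar ξ y) ξ = c ξ := fun ξ => by
    rw [← zpFourier_tsum (a := c) (summable_of_ne_finset_zero (s := c.support) fun ξ h => by
      rw [h0 ξ h, norm_zero]) ξ]
    congr 1
    funext y
    rw [tsum_eq_sum fun ξ h => by rw [h0 ξ h, zero_mul]]
  rw [pseudoDiff, tsum_eq_sum (s := c.support) fun ξ h => by rw [h1, h0 ξ h]; ring]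
  refine Finset.sum_congr rfl fun ξ _ => ?_
  rw [h1]; ring

/-- By linearity the condition may be tested on characters, where `T_σ χ_ξ = σ(·, ξ) χ_ξ`. -/
theorem isBoundedExtension_iff {σ : ZpPow p d → ZpDual p d → ℂ} {A : ZpL2 p d →L[ℂ] ZpL2 p d} :
    IsBoundedExtension σ A ↔ ∀ ξ, (A (zpCharL2 ξ) : ZpPow p d → ℂ) =ᵐ[zpHaar p d]
      fun x => σ x ξ * zpChar ξ x := by
  constructor
  · intro h ξ
    refine (h (zpCharC ξ) (Submodule.subset_span ⟨ξ, rfl⟩)).trans (Eventually.of_forall fun x => ?_)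
    have h1 := pseudoDiff_sum σ (Finsupp.single ξ 1) x
    simp only [Finsupp.support_single, one_ne_zero, ne_eq, not_false_eq_true] at h1
    simp only [Finset.sum_singleton, Finsupp.single_eq_same, one_mul] at h1
    exact h1
  · intro h f hf
    obtain ⟨c, hc⟩ := Finsupp.mem_span_range_iff_exists_finsupp.1 hf
    have h1 : (f : ZpPow p d → ℂ) = fun y => ∑ ξ ∈ c.support, c ξ * zpChar ξ y := by
      funext y
      rw [← hc, Finsupp.sum, ContinuousMap.sum_apply]
      rfl
    rw [h1, funext (pseudoDiff_sum σ c)]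
    have h2 : A (ContinuousMap.toLp 2 (zpHaar p d) ℂ f)
        = ∑ ξ ∈ c.support, c ξ • A (zpCharL2 ξ) := by
      rw [← hc, Finsupp.sum, map_sum, map_sum]
      simp only [map_smul]
    rw [h2]
    exact zpL2_coeFn_sum_smul _ _ _ _ h

theorem eLpNorm_mul_zpChar (f : ZpPow p d → ℂ) (ξ : ZpDual p d) (q : ℝ≥0∞) :
    eLpNorm (fun x => f x * zpChar ξ x) q (zpHaar p d) = eLpNorm f q (zpHaar p d) :=
  eLpNorm_congr_norm_ae (Eventually.of_forall fun x => by rw [norm_mul, norm_zpChar, mul_one])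

theorem enorm_eq_of_ae_eq_mul_zpChar {v : ZpL2 p d} {f : ZpPow p d → ℂ} {ξ : ZpDual p d}
    (h : (v : ZpPow p d → ℂ) =ᵐ[zpHaar p d] fun x => f x * zpChar ξ x) :
    ‖v‖ₑ = eLpNorm f 2 (zpHaar p d) := by
  rw [Lp.enorm_def, eLpNorm_congr_ae h, eLpNorm_mul_zpChar]

theorem exists_ae_eq_mul_zpChar {f : ZpPow p d → ℂ} (hf : MemLp f 2 (zpHaar p d))
    (ξ : ZpDual p d) :
    ∃ v : ZpL2 p d, (v : ZpPow p d → ℂ) =ᵐ[zpHaar p d] fun x => f x * zpChar ξ x := by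
  have h : MemLp (fun x => f x * zpChar ξ x) 2 (zpHaar p d) :=
    ⟨hf.1.mul (continuous_zpChar ξ).aestronglyMeasurable, by
      rw [eLpNorm_mul_zpChar]; exact hf.2⟩
  exact ⟨h.toLp _, h.coeFn_toLp⟩

theorem IsBoundedExtension.tsum_sq_enorm {σ : ZpPow p d → ZpDual p d → ℂ}
    {A : ZpL2 p d →L[ℂ] ZpL2 p d} (hA : IsBoundedExtension σ A) {ι : Type*}
    (e : HilbertBasis ι ℂ (ZpL2 p d)) :
    ∑' i, ‖A (e i)‖ₑ ^ 2 = ∑' ξ : ZpDual p d, eLpNorm (fun x => σ x ξ) 2 (zpHaar p d) ^ 2 := by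
  rw [e.tsum_sq_enorm_apply_eq (zpBasis p d)]
  refine tsum_congr fun ξ => ?_
  rw [zpBasis_apply, enorm_eq_of_ae_eq_mul_zpChar (isBoundedExtension_iff.1 hA ξ)]

theorem summable_sq_norm_iff {ι E : Type*} [NormedAddCommGroup E] (f : ι → E) :
    Summable (fun i => ‖f i‖ ^ 2) ↔ ∑' i, ‖f i‖ₑ ^ 2 < ∞ := by
  have h : ∀ i, ‖f i‖ₑ ^ 2 = ((‖f i‖₊ ^ 2 : NNReal) : ℝ≥0∞) := fun i => by
    rw [ENNReal.coe_pow]; rfl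
  simp only [h, lt_top_iff_ne_top, ENNReal.tsum_coe_ne_top_iff_summable]
  rw [← NNReal.summable_coe]
  simp

theorem exists_isBoundedExtension_isHilbertSchmidt_iff {σ : ZpPow p d → ZpDual p d → ℂ}
    (hσ : ∀ ξ, Measurable fun x => σ x ξ) :
    (∃ A : ZpL2 p d →L[ℂ] ZpL2 p d, IsBoundedExtension σ A ∧ IsHilbertSchmidt A) ↔
      ∑' ξ : ZpDual p d, eLpNorm (fun x => σ x ξ) 2 (zpHaar p d) ^ 2 < ∞ := by
  constructor
  · rintro ⟨A, hA, hHS⟩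
    rw [← hA.tsum_sq_enorm (zpBasis p d), ← summable_sq_norm_iff]
    exact hHS _ _
  · intro h
    have h1 : ∀ ξ, eLpNorm (fun x => σ x ξ) 2 (zpHaar p d) < ∞ := fun ξ => by
      have h2 := (ENNReal.le_tsum ξ).trans_lt h
      exact (ENNReal.pow_lt_top_iff.1 h2).resolve_right two_ne_zero
    choose v hv using fun ξ => exists_ae_eq_mul_zpChar ⟨(hσ ξ).aestronglyMeasurable, h1 ξ⟩ ξ
    obtain ⟨A, hA⟩ := (zpBasis p d).exists_clm_of_summable v (by
      rw [summable_sq_norm_iff]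
      simpa only [enorm_eq_of_ae_eq_mul_zpChar (hv _)] using h)
    have hA' : IsBoundedExtension σ A := isBoundedExtension_iff.2 fun ξ => by
      rw [← zpBasis_apply, hA]
      exact hv ξ
    refine ⟨A, hA', fun ι e => ?_⟩
    rw [summable_sq_norm_iff, hA'.tsum_sq_enorm]
    exact h

end BoundedExtensions

/-! ### Decay of the Fourier coefficients of a symbol. -/

section SymbolCoefficients

open Filter Topology

variable {p : ℕ} [Fact p.Prime] {d : ℕ} {ρ : ℝ} {σ : ZpPow p d → ZpDual p d → ℂ}

theorem pow_zpWeight_le (ζ : ZpDual p d) (β : ℕ) : zpWeight ζ ^ β ≤ 1 + ‖ζ‖ ^ β := by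
  rcases max_cases 1 ‖ζ‖ with h | h
  · rw [zpWeight, h.1, one_pow]
    exact le_add_of_nonneg_right (by positivity)
  · rw [zpWeight, h.1]
    exact le_add_of_nonneg_left zero_le_one

theorem zpFourier_vladimirov {f : ZpPow p d → ℂ} {β : ℕ}
    (h : Summable fun ζ : ZpDual p d => ‖ζ‖ ^ β * ‖zpFourier f ζ‖) (ζ : ZpDual p d) :
    zpFourier (vladimirov β f) ζ = ((‖ζ‖ ^ β : ℝ) : ℂ) * zpFourier f ζ := by
  refine zpFourier_tsum (a := fun ζ => ((‖ζ‖ ^ β : ℝ) : ℂ) * zpFourier f ζ) (h.congr fun ζ => ?_) ζ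
  rw [norm_mul, Complex.norm_real, Real.norm_of_nonneg (by positivity)]

/-- A Fourier coefficient is at most the supremum of the function, here applied to `D^β` of the
difference. Order `0` is used besides `β` because `‖ζ‖ ^ β` does not dominate the weight at `ζ = 0`.
-/
theorem IsHormanderSymbol.exists_zpFourier_dualDiff_le (hσ : IsHormanderSymbol 0 ρ 0 σ)
    (α β : ℕ) : ∃ C : ℝ, 0 < C ∧ ∀ ζ ξ η : ZpDual p d,
      zpWeight ζ ^ β * ‖zpFourier (fun x => dualDiff η (σ x) ξ) ζ‖
        ≤ C * (‖η‖ ^ α * zpWeight ξ ^ (-(ρ * α))) := by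
  obtain ⟨C₀, hC₀, h₀⟩ := hσ.estimate α 0
  obtain ⟨C₁, hC₁, h₁⟩ := hσ.estimate α β
  refine ⟨C₀ + C₁, by positivity, fun ζ ξ η => ?_⟩
  have key : ∀ (γ : ℕ) (C : ℝ), (∀ (x : ZpPow p d) (ξ η : ZpDual p d),
      ‖vladimirov γ (fun y => dualDiff η (σ y) ξ) x‖
        ≤ C * ‖η‖ ^ α * zpWeight ξ ^ (0 - ρ * α + 0 * γ)) →
      ‖ζ‖ ^ γ * ‖zpFourier (fun x => dualDiff η (σ x) ξ) ζ‖
        ≤ C * (‖η‖ ^ α * zpWeight ξ ^ (-(ρ * α))) := by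
    intro γ C h
    have h2 := norm_zpFourier_le ζ fun x => h x ξ η
    rw [zpFourier_vladimirov (hσ.summable γ ξ η), norm_mul, Complex.norm_real,
      Real.norm_of_nonneg (by positivity), zero_mul, add_zero, zero_sub, mul_assoc] at h2
    exact h2
  have k0 := key 0 C₀ h₀
  have k1 := key β C₁ h₁
  rw [pow_zero, one_mul] at k0
  calc zpWeight ζ ^ β * ‖zpFourier (fun x => dualDiff η (σ x) ξ) ζ‖
      ≤ (1 + ‖ζ‖ ^ β) * ‖zpFourier (fun x => dualDiff η (σ x) ξ) ζ‖ := by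
        gcongr
        exact pow_zpWeight_le ζ β
    _ ≤ _ := by rw [add_mul, one_mul, add_mul]; exact add_le_add k0 k1

theorem norm_zpFourier_le_integral (f : ZpPow p d → ℂ) (ξ : ZpDual p d) :
    ‖zpFourier f ξ‖ ≤ ∫ x, ‖f x‖ ∂(zpHaar p d) := by
  refine (norm_integral_le_integral_norm _).trans (le_of_eq ?_)
  simp only [norm_mul, RCLike.norm_conj, norm_zpChar, mul_one]

theorem zpFourier_dualDiff (h : ∀ ξ, Integrable (fun x => σ x ξ) (zpHaar p d))
    (ξ η ζ : ZpDual p d) : zpFourier (fun x => dualDiff η (σ x) ξ) ζ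
      = zpFourier (fun x => σ x (ξ + η)) ζ - zpFourier (fun x => σ x ξ) ζ :=
  zpFourier_sub (h _) (h _) ζ

/-- If the symbol tends to zero in mean, then it is smooth in the space variable. -/
theorem IsHormanderSymbol.exists_zpFourier_le (hσ : IsHormanderSymbol 0 ρ 0 σ)
    (hint : ∀ ξ, Integrable (fun x => σ x ξ) (zpHaar p d))
    (h0 : Tendsto (fun ξ => ∫ x, ‖σ x ξ‖ ∂(zpHaar p d)) cofinite (𝓝 0)) (β : ℕ) :
    ∃ C : ℝ, ∀ ζ ξ : ZpDual p d, zpWeight ζ ^ β * ‖zpFourier (fun x => σ x ξ) ζ‖ ≤ C := by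
  rcases finite_or_infinite (ZpDual p d) with hfin | hinf
  -- For a finite dual group the cofinite filter is trivial and the limit argument below is void,
  -- but a maximum exists.
  · obtain ⟨q, hq⟩ := Finite.exists_max fun q : ZpDual p d × ZpDual p d =>
      zpWeight q.1 ^ β * ‖zpFourier (fun x => σ x q.2) q.1‖
    exact ⟨_, fun ζ ξ => hq (ζ, ξ)⟩
  · obtain ⟨C, hC, h⟩ := hσ.exists_zpFourier_dualDiff_le 0 β
    have h1 : ∀ ζ ξ, zpWeight ζ ^ β *
        ‖zpFourier (fun x => σ x ξ) ζ - zpFourier (fun x => σ x 0) ζ‖ ≤ C := fun ζ ξ => by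
      have := h ζ 0 ξ
      rw [zpFourier_dualDiff hint] at this
      simpa [zpWeight] using this
    -- The estimate with `α = 0` bounds differences uniformly in both frequencies, by passing
    -- through frequency `0`. Letting `ξ'` tend to infinity removes the subtracted coefficient.
    refine ⟨C + C, fun ζ ξ => ?_⟩
    have h2 : Tendsto (fun ξ' => zpFourier (fun x => σ x ξ') ζ) cofinite (𝓝 0) :=
      squeeze_zero_norm (fun ξ' => norm_zpFourier_le_integral _ _) h0
    have h3 : Tendsto (fun ξ' => zpWeight ζ ^ β *
        ‖zpFourier (fun x => σ x ξ) ζ - zpFourier (fun x => σ x ξ') ζ‖) cofinite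
        (𝓝 (zpWeight ζ ^ β * ‖zpFourier (fun x => σ x ξ) ζ - 0‖)) :=
      (tendsto_const_nhds.sub h2).norm.const_mul _
    rw [sub_zero] at h3
    refine le_of_tendsto h3 (Eventually.of_forall fun ξ' => ?_)
    calc _ ≤ zpWeight ζ ^ β * (‖zpFourier (fun x => σ x ξ) ζ - zpFourier (fun x => σ x 0) ζ‖
          + ‖zpFourier (fun x => σ x ξ') ζ - zpFourier (fun x => σ x 0) ζ‖) := by
          have := zpWeight_pos ζ
          gcongr
          rw [norm_sub_rev (zpFourier (fun x => σ x ξ') ζ)]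
          exact norm_sub_le_norm_sub_add_norm_sub _ _ _
      _ ≤ _ := by rw [mul_add]; exact add_le_add (h1 ζ ξ) (h1 ζ ξ')

end SymbolCoefficients

/-! ### The partition of the dual group into blocks. -/

section Blocks

open Filter Topology

variable {p : ℕ} [Fact p.Prime] {d : ℕ}

/-- The finite subgroup of frequencies of norm at most `R`. -/
def zpDualBall (p : ℕ) [Fact p.Prime] (d : ℕ) {R : ℝ} (hR : 0 ≤ R) : AddSubgroup (ZpDual p d) where
  carrier := {ζ | ‖ζ‖ ≤ R}
  add_mem' := fun h h' => (norm_add_le_max_zpDual _ _).trans (max_le h h')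
  zero_mem' := by simpa using hR
  neg_mem' := fun {ζ} h => by simpa using h

theorem mem_zpDualBall {R : ℝ} {hR : 0 ≤ R} {ζ : ZpDual p d} :
    ζ ∈ zpDualBall p d hR ↔ ‖ζ‖ ≤ R := Iff.rfl

noncomputable instance fintype_zpDualBall {R : ℝ} (hR : 0 ≤ R) : Fintype (zpDualBall p d hR) :=
  (finite_norm_le_zpDual p d R).fintype

theorem zpWeight_rpow_nonneg (ξ : ZpDual p d) (ε : ℝ) : 0 ≤ zpWeight ξ ^ ε :=
  Real.rpow_nonneg (zpWeight_pos ξ).le _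

/-- If `ξ ≠ 0` then `‖ξ‖ > 1`, so the radius is below `‖ξ‖` and the ultrametric inequality forces
equal norms. Constant weight on the ball is what makes the block relation symmetric and transitive.
-/
theorem zpWeight_eq_of_norm_sub_le {ε : ℝ} (hε : ε < 1) {ξ ξ' : ZpDual p d}
    (h : ‖ξ' - ξ‖ ≤ zpWeight ξ ^ ε) : zpWeight ξ' = zpWeight ξ := by
  by_cases hξ : ξ = 0
  · subst hξ
    have h1 : zpWeight (0 : ZpDual p d) = 1 := by simp [zpWeight]
    rw [sub_zero, h1, Real.one_rpow] at h
    rw [h1, zpWeight, max_eq_left h]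
  · have h1 := one_lt_norm_zpDual hξ
    have h2 : ‖ξ' - ξ‖ < ‖ξ‖ := by
      rw [zpWeight, max_eq_right h1.le] at h
      exact h.trans_lt (Real.rpow_lt_self_of_one_lt h1 hε)
    have h3 : ‖ξ'‖ ≤ ‖ξ‖ := by
      have := norm_add_le_max_zpDual (ξ' - ξ) ξ
      rwa [sub_add_cancel, max_eq_right h2.le] at this
    have h4 : ‖ξ‖ ≤ ‖ξ'‖ := by
      have := norm_add_le_max_zpDual (-(ξ' - ξ)) ξ'
      rw [neg_sub, sub_add_cancel] at this
      rcases le_max_iff.1 this with h | h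
      · rw [norm_sub_rev] at h
        exact absurd h (not_le.2 h2)
      · exact h
    rw [zpWeight, zpWeight, le_antisymm h3 h4]

/-- Frequencies are equivalent if their distance is at most the power `ε` of their weight. -/
noncomputable def blockSetoid (p : ℕ) [Fact p.Prime] (d : ℕ) {ε : ℝ} (hε : ε < 1) : Setoid (ZpDual p d) where
  r ξ ξ' := ‖ξ' - ξ‖ ≤ zpWeight ξ ^ ε
  iseqv :=
    { refl := fun ξ => by simpa using zpWeight_rpow_nonneg ξ ε
      symm := fun {ξ ξ'} h => by
        rw [norm_sub_rev, zpWeight_eq_of_norm_sub_le hε h]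
        exact h
      trans := fun {ξ ξ' ξ''} h h' => by
        rw [zpWeight_eq_of_norm_sub_le hε h] at h'
        rw [← sub_add_sub_cancel]
        exact (norm_add_le_max_zpDual _ _).trans (max_le h' h) }

/-- The set of blocks. -/
abbrev FreqBlock (p : ℕ) [Fact p.Prime] (d : ℕ) {ε : ℝ} (hε : ε < 1) : Type :=
  Quotient (blockSetoid p d hε)

/-- The group of differences of frequencies in a block. -/
noncomputable abbrev blockGroup {ε : ℝ} {hε : ε < 1} (b : FreqBlock p d hε) : AddSubgroup (ZpDual p d) :=
  zpDualBall p d (zpWeight_rpow_nonneg b.out ε)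

theorem mk_out_add {ε : ℝ} {hε : ε < 1} (b : FreqBlock p d hε) (ζ : blockGroup b) :
    (Quotient.mk _ (b.out + ζ) : FreqBlock p d hε) = b := by
  conv_rhs => rw [← b.out_eq]
  refine (Quotient.sound (?_ : ‖b.out + (ζ : ZpDual p d) - b.out‖ ≤ zpWeight b.out ^ ε)).symm
  rw [add_sub_cancel_left]
  exact ζ.2

theorem norm_sub_out_le {ε : ℝ} (hε : ε < 1) (ξ : ZpDual p d) :
    ‖ξ - (Quotient.mk _ ξ : FreqBlock p d hε).out‖
      ≤ zpWeight (Quotient.mk _ ξ : FreqBlock p d hε).out ^ ε :=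
  Quotient.mk_out (s := blockSetoid p d hε) ξ

theorem zpWeight_out {ε : ℝ} (hε : ε < 1) (ξ : ZpDual p d) :
    zpWeight (Quotient.mk _ ξ : FreqBlock p d hε).out = zpWeight ξ :=
  (zpWeight_eq_of_norm_sub_le hε (norm_sub_out_le hε ξ)).symm

/-- Every frequency is the sum of the representative of its block and of an element of the group
of the block. -/
noncomputable def blockEquiv (p : ℕ) [Fact p.Prime] (d : ℕ) {ε : ℝ} (hε : ε < 1) :
    (Σ b : FreqBlock p d hε, blockGroup b) ≃ ZpDual p d :=
  Equiv.ofBijective (fun s => s.1.out + s.2) (by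
    constructor
    · rintro ⟨b, ζ⟩ ⟨b', ζ'⟩ h
      have hb : b = b' := by
        rw [← mk_out_add b ζ, ← mk_out_add b' ζ']
        exact congrArg _ h
      subst hb
      have h2 : ζ = ζ' := Subtype.ext (add_left_cancel h)
      rw [h2]
    · intro ξ
      exact ⟨⟨Quotient.mk _ ξ, ⟨_, norm_sub_out_le hε ξ⟩⟩, add_sub_cancel _ _⟩)

theorem blockEquiv_apply {ε : ℝ} {hε : ε < 1} (b : FreqBlock p d hε) (ζ : blockGroup b) :
    blockEquiv p d hε ⟨b, ζ⟩ = b.out + ζ := rfl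

/-- The basis of characters, indexed by blocks. -/
noncomputable def blockBasis (p : ℕ) [Fact p.Prime] (d : ℕ) {ε : ℝ} (hε : ε < 1) :
    HilbertBasis (Σ b : FreqBlock p d hε, blockGroup b) ℂ (ZpL2 p d) :=
  HilbertBasis.mk ((orthonormal_zpCharL2 p d).comp _ (blockEquiv p d hε).injective) (by
    rw [(blockEquiv p d hε).surjective.range_comp]
    exact (span_zpCharL2_topologicalClosure p d).ge)

theorem blockBasis_apply {ε : ℝ} {hε : ε < 1} (s : Σ b : FreqBlock p d hε, blockGroup b) :
    blockBasis p d hε s = zpCharL2 (blockEquiv p d hε s) := by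
  rw [blockBasis, HilbertBasis.coe_mk]; rfl

end Blocks

/-! ### Equidistribution of the characters induced on a finite subgroup. -/

section TrigonometricPolynomials

variable {p : ℕ} [Fact p.Prime] {d : ℕ}

/-- The characters of a subgroup of the dual group given by the points of `ℤ_p^d`. -/
noncomputable def evalChar (G : AddSubgroup (ZpDual p d)) (x : ZpPow p d) : AddChar G ℂ where
  toFun ζ := zpChar ζ x
  map_zero_eq_one' := zpChar_zero_left x
  map_add_eq_mul' ζ η := by rw [AddSubgroup.coe_add, zpChar_add_left]

theorem evalChar_apply (G : AddSubgroup (ZpDual p d)) (x : ZpPow p d) (ζ : G) :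
    evalChar G x ζ = zpChar ζ x := rfl

theorem measurableSet_evalChar_eq (G : AddSubgroup (ZpDual p d)) (ψ : AddChar G ℂ) :
    MeasurableSet {x | evalChar G x = ψ} := by
  have h : {x | evalChar G x = ψ} = ⋂ ζ : G, {x | zpChar (ζ : ZpDual p d) x = ψ ζ} := by
    ext x
    simp [DFunLike.ext_iff, evalChar_apply]
  rw [h]
  exact (isClosed_iInter fun ζ => isClosed_eq (continuous_zpChar _) continuous_const).measurableSet

/-- The points of `ℤ_p^d` give all characters of a finite subgroup, with equal probability. -/
theorem zpHaar_evalChar_eq (G : AddSubgroup (ZpDual p d)) [Fintype G] (ψ : AddChar G ℂ) :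
    zpHaar p d {x | evalChar G x = ψ} = (Fintype.card G : ℝ≥0∞)⁻¹ := by
  classical
  have hcard : (Fintype.card G : ℂ) ≠ 0 := by exact_mod_cast Fintype.card_ne_zero
  -- Orthogonality on `G` writes the indicator, up to the factor `|G|`, as a trigonometric
  -- polynomial; only its term `ζ = 0` has a nonzero integral.
  have h1 : ∀ x, ∑ ζ : G, zpChar (ζ : ZpDual p d) x * conj (ψ ζ)
      = {x | evalChar G x = ψ}.indicator (fun _ => (Fintype.card G : ℂ)) x := fun x => by
    have h2 : ∀ ζ : G, zpChar (ζ : ZpDual p d) x * conj (ψ ζ) = (evalChar G x - ψ) ζ := fun ζ => by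
      rw [AddChar.sub_apply, AddChar.map_neg_eq_conj, evalChar_apply]
    simp only [h2, AddChar.sum_eq_ite, sub_eq_zero, Set.indicator_apply, Set.mem_ofPred_eq]
  have h3 : ∫ x, ∑ ζ : G, zpChar (ζ : ZpDual p d) x * conj (ψ ζ) ∂(zpHaar p d) = 1 := by
    rw [integral_finsetSum]
    · simp only [integral_mul_const, integral_zpChar, ite_mul, one_mul, zero_mul]
      rw [Finset.sum_eq_single 0]
      · simp
      · intro ζ _ hζ
        rw [if_neg]
        exact_mod_cast hζ
      · simp
    · intro ζ _
      exact ((continuous_zpChar _).integrable_of_hasCompactSupport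
        (HasCompactSupport.of_compactSpace _)).mul_const _
  simp only [h1] at h3
  rw [integral_indicator_const _ (measurableSet_evalChar_eq G ψ), Complex.real_smul] at h3
  have h4 : (zpHaar p d).real {x | evalChar G x = ψ} * (Fintype.card G : ℝ) = 1 := by
    exact_mod_cast h3
  have h5 : (zpHaar p d).real {x | evalChar G x = ψ} = (Fintype.card G : ℝ)⁻¹ :=
    eq_inv_of_mul_eq_one_left h4
  rw [← ofReal_measureReal, h5, ENNReal.ofReal_inv_of_pos (by exact_mod_cast Fintype.card_pos),
    ENNReal.ofReal_natCast]

theorem card_mul_lintegral_evalChar (G : AddSubgroup (ZpDual p d)) [Fintype G]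
    (F : AddChar G ℂ → ℝ≥0∞) :
    (Fintype.card G : ℝ≥0∞) * ∫⁻ x, F (evalChar G x) ∂(zpHaar p d) = ∑ ψ, F ψ := by
  classical
  have h1 : ∀ x, F (evalChar G x)
      = ∑ ψ, {x | evalChar G x = ψ}.indicator (fun _ => F ψ) x := fun x => by
    simp [Set.indicator_apply]
  simp only [h1]
  rw [lintegral_finsetSum _ fun ψ _ => measurable_const.indicator (measurableSet_evalChar_eq G ψ),
    Finset.mul_sum]
  refine Finset.sum_congr rfl fun ψ _ => ?_
  rw [lintegral_indicator_const (measurableSet_evalChar_eq G ψ), zpHaar_evalChar_eq,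
    mul_left_comm, ENNReal.mul_inv_cancel, mul_one]
  · exact_mod_cast Fintype.card_ne_zero
  · exact ENNReal.natCast_ne_top _

theorem eLpNorm_ofReal_rpow {f : ZpPow p d → ℂ} {γ : ℝ} (hγ : 0 < γ) :
    eLpNorm f (ENNReal.ofReal γ) (zpHaar p d) ^ γ = ∫⁻ x, ‖f x‖ₑ ^ γ ∂(zpHaar p d) := by
  rw [eLpNorm_eq_lintegral_rpow_enorm_toReal (by simpa using hγ) ENNReal.ofReal_ne_top,
    ENNReal.toReal_ofReal hγ.le, ← ENNReal.rpow_mul, one_div, inv_mul_cancel₀ hγ.ne',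
    ENNReal.rpow_one]

end TrigonometricPolynomials

/-! ### Block symbols and their eigenvalues. -/

section BlockSymbol

variable {p : ℕ} [Fact p.Prime] {d : ℕ}

/-- The trigonometric polynomial on the group of a block whose coefficients are those that `c`
gives at the representative of the block. -/
noncomputable def blockPoly {ε : ℝ} {hε : ε < 1} (c : ZpDual p d → ZpDual p d → ℂ)
    (b : FreqBlock p d hε) (x : ZpPow p d) : ℂ :=
  ∑ θ : blockGroup b, c b.out θ * zpChar (θ : ZpDual p d) x

/-- The block symbol with coefficients `c`. -/
noncomputable def blockSymbol {ε : ℝ} (hε : ε < 1) (c : ZpDual p d → ZpDual p d → ℂ)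
    (x : ZpPow p d) (ξ : ZpDual p d) : ℂ :=
  blockPoly c (Quotient.mk _ ξ : FreqBlock p d hε) x

/-- The eigenvalues of the operator given by a block symbol. -/
noncomputable def blockEigenvalue {ε : ℝ} {hε : ε < 1} (c : ZpDual p d → ZpDual p d → ℂ)
    (i : Σ b : FreqBlock p d hε, AddChar (blockGroup b) ℂ) : ℂ :=
  ∑ θ : blockGroup i.1, c i.1.out θ * i.2 θ

variable {ε : ℝ} {hε : ε < 1} {c : ZpDual p d → ZpDual p d → ℂ}

theorem blockSymbol_out_add (b : FreqBlock p d hε) (ζ : blockGroup b) (x : ZpPow p d) :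
    blockSymbol hε c x (b.out + ζ)
      = ∑ θ : blockGroup b, c b.out θ * zpChar (θ : ZpDual p d) x := by
  rw [blockSymbol, mk_out_add b ζ, blockPoly]

theorem continuous_blockSymbol (ξ : ZpDual p d) : Continuous fun x => blockSymbol hε c x ξ :=
  continuous_finsetSum _ fun _ _ => continuous_const.mul (continuous_zpChar _)

/-- The block symbol at `x` is the eigenvalue at the character that `x` induces on the group of the
block. It is the same for all frequencies of the block, and their number cancels the probability `1
/ |G|` of each character. -/
theorem tsum_eLpNorm_blockSymbol {γ : ℝ} (hγ : 0 < γ) :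
    ∑' ξ, eLpNorm (fun x => blockSymbol hε c x ξ) (ENNReal.ofReal γ) (zpHaar p d) ^ γ
      = ∑' i : Σ b : FreqBlock p d hε, AddChar (blockGroup b) ℂ, ‖blockEigenvalue c i‖ₑ ^ γ := by
  simp only [eLpNorm_ofReal_rpow hγ]
  rw [← (blockEquiv p d hε).tsum_eq, ENNReal.tsum_sigma', ENNReal.tsum_sigma']
  refine tsum_congr fun b => ?_
  simp only [blockEquiv_apply, blockSymbol_out_add, tsum_fintype, Finset.sum_const,
    Finset.card_univ, nsmul_eq_mul]
  exact card_mul_lintegral_evalChar (blockGroup b) fun ψ => ‖blockEigenvalue c ⟨b, ψ⟩‖ₑ ^ γ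

/-- The operators given by block symbols are those which are diagonal in the block Fourier
basis. -/
theorem blockFourier_apply_iff_isBoundedExtension {A : ZpL2 p d →L[ℂ] ZpL2 p d} :
    (∀ i, A ((blockBasis p d hε).blockFourier i)
      = blockEigenvalue c i • (blockBasis p d hε).blockFourier i) ↔
      IsBoundedExtension (blockSymbol hε c) A := by
  have h := (blockBasis p d hε).forall_blockFourier_apply_iff A
    (fun b (θ : blockGroup b) => c b.out θ)
  refine h.trans ?_
  rw [isBoundedExtension_iff, ← (blockEquiv p d hε).forall_congr_right, Sigma.forall]
  refine forall_congr' fun b => forall_congr' fun ζ => ?_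
  simp only [blockBasis_apply, blockEquiv_apply, blockSymbol_out_add]
  have h1 := zpL2_coeFn_sum_smul Finset.univ (fun θ : blockGroup b => c b.out θ)
    (fun θ => zpCharL2 (b.out + ((ζ + θ : blockGroup b) : ZpDual p d))) _
    fun θ => coeFn_zpCharL2 _
  -- Multiplication by the block symbol moves a frequency only inside its block, because `ζ + θ`
  -- stays in the group.
  have h2 : (fun x => (∑ θ : blockGroup b, c b.out θ * zpChar (θ : ZpDual p d) x)
      * zpChar (b.out + (ζ : ZpDual p d)) x)
      = fun x => ∑ θ : blockGroup b, c b.out θ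
        * zpChar (b.out + ((ζ + θ : blockGroup b) : ZpDual p d)) x := by
    funext x
    rw [Finset.sum_mul]
    refine Finset.sum_congr rfl fun θ _ => ?_
    rw [AddSubgroup.coe_add, ← add_assoc, zpChar_add_left _ (θ : ZpDual p d)]
    ring
  rw [h2]
  exact ⟨fun h => h ▸ h1, fun h => Lp.ext (h.trans h1.symm)⟩

end BlockSymbol

/-! ### Approximation of a symbol by its block symbol. -/

section BlockApproximation

open Filter Topology

variable {p : ℕ} [Fact p.Prime] {d : ℕ} {ρ : ℝ} {σ : ZpPow p d → ZpDual p d → ℂ}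

/-- The Fourier coefficients of a symbol in the space variable. -/
noncomputable def symbolCoeff (σ : ZpPow p d → ZpDual p d → ℂ) (ξ ζ : ZpDual p d) : ℂ :=
  zpFourier (fun x => σ x ξ) ζ

theorem pow_le_rpow_zpWeight {N K : ℕ} {ε : ℝ} (h : N ≤ ε * K) (ξ : ZpDual p d) :
    zpWeight ξ ^ N ≤ (zpWeight ξ ^ ε) ^ K := by
  rw [← Real.rpow_natCast, ← Real.rpow_natCast, ← Real.rpow_mul (zpWeight_pos ξ).le]
  exact Real.rpow_le_rpow_of_exponent_le (one_le_zpWeight ξ) h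

/-- The coefficients of the difference of a symbol and of its block symbol decrease rapidly. -/
theorem IsHormanderSymbol.exists_symbolCoeff_sub_le (hσ : IsHormanderSymbol 0 ρ 0 σ) (hρ : 0 < ρ)
    (hε : ρ / 2 < 1) (hint : ∀ ξ, Integrable (fun x => σ x ξ) (zpHaar p d))
    (h0 : Tendsto (fun ξ => ∫ x, ‖σ x ξ‖ ∂(zpHaar p d)) cofinite (𝓝 0)) (N : ℕ) :
    ∃ C : ℝ, ∀ ξ ζ : ZpDual p d,
      ‖symbolCoeff σ ξ ζ - (blockGroup (Quotient.mk _ ξ : FreqBlock p d hε) : Set _).indicator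
        (symbolCoeff σ (Quotient.mk _ ξ : FreqBlock p d hε).out) ζ‖
        ≤ C * (zpWeight ξ ^ N)⁻¹ * (zpWeight ζ ^ (d + 1))⁻¹ := by
  -- This `K` gives `⟨ξ⟩^N ≤ (⟨ξ⟩^(ρ/2))^K`. In the two bounds that follow, the exponent `d + 1` is
  -- reserved for summability in `ζ`.
  obtain ⟨K, hK⟩ := exists_nat_ge ((N : ℝ) / (ρ / 2))
  rw [div_le_iff₀ (by positivity), mul_comm] at hK
  obtain ⟨C₁, h₁⟩ := hσ.exists_zpFourier_le hint h0 (d + 1 + K)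
  obtain ⟨C₂, hC₂, h₂⟩ := hσ.exists_zpFourier_dualDiff_le K (d + 1)
  refine ⟨max C₁ C₂, fun ξ ζ => ?_⟩
  set r := (Quotient.mk _ ξ : FreqBlock p d hε).out with hr
  have hw : zpWeight r = zpWeight ξ := zpWeight_out hε ξ
  have hξ := zpWeight_pos ξ
  have hζ := zpWeight_pos ζ
  have hR : 0 < zpWeight ξ ^ (ρ / 2) := Real.rpow_pos_of_pos hξ _
  have hNK := pow_le_rpow_zpWeight hK ξ
  rw [mul_assoc, ← mul_inv, ← div_eq_mul_inv, le_div_iff₀ (by positivity)]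
  by_cases h : ζ ∈ blockGroup (Quotient.mk _ ξ : FreqBlock p d hε)
  · rw [Set.indicator_of_mem (SetLike.mem_coe.2 h)]
    have h3 := h₂ ζ r (ξ - r)
    rw [zpFourier_dualDiff hint, add_sub_cancel, hw] at h3
    have h4 : ‖ξ - r‖ ^ K * zpWeight ξ ^ (-(ρ * K)) ≤ (zpWeight ξ ^ N)⁻¹ := by
      have h5 : ‖ξ - r‖ ≤ zpWeight ξ ^ (ρ / 2) := hw ▸ norm_sub_out_le hε ξ
      -- Half of the gain `⟨ξ⟩^(-ρK)` pays for `‖ξ - r‖ ^ K`; the other half is the decay that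
      -- remains.
      have h6 : zpWeight ξ ^ (-(ρ * K)) = ((zpWeight ξ ^ (ρ / 2)) ^ K)⁻¹
          * ((zpWeight ξ ^ (ρ / 2)) ^ K)⁻¹ := by
        rw [Real.rpow_neg hξ.le, ← mul_inv, ← Real.rpow_natCast, ← Real.rpow_mul hξ.le,
          ← Real.rpow_add hξ]
        congr 2
        ring
      calc ‖ξ - r‖ ^ K * zpWeight ξ ^ (-(ρ * K))
          ≤ (zpWeight ξ ^ (ρ / 2)) ^ K * zpWeight ξ ^ (-(ρ * K)) := by
            have := zpWeight_rpow_nonneg ξ (-(ρ * K))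
            gcongr
        _ = ((zpWeight ξ ^ (ρ / 2)) ^ K)⁻¹ := by
            rw [h6, ← mul_assoc, mul_inv_cancel₀ (by positivity), one_mul]
        _ ≤ _ := by gcongr
    calc ‖symbolCoeff σ ξ ζ - symbolCoeff σ r ζ‖ * (zpWeight ξ ^ N * zpWeight ζ ^ (d + 1))
        = (zpWeight ζ ^ (d + 1) * ‖symbolCoeff σ ξ ζ - symbolCoeff σ r ζ‖) * zpWeight ξ ^ N := by
          ring
      _ ≤ (C₂ * (zpWeight ξ ^ N)⁻¹) * zpWeight ξ ^ N := by
          exact mul_le_mul_of_nonneg_right (h3.trans (mul_le_mul_of_nonneg_left h4 hC₂.le))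
            (by positivity)
      _ = C₂ := by rw [mul_assoc, inv_mul_cancel₀ (by positivity), mul_one]
      _ ≤ _ := le_max_right _ _
  -- Outside the block group `⟨ζ⟩` exceeds the radius `⟨ξ⟩^(ρ/2)`, so decay in `ζ` is decay in `ξ`.
  · rw [Set.indicator_of_notMem (by exact h), sub_zero]
    have h3 : zpWeight ξ ^ (ρ / 2) ≤ zpWeight ζ := by
      rw [mem_zpDualBall, not_le, ← hr, hw] at h
      exact h.le.trans (norm_le_zpWeight ζ)
    calc ‖symbolCoeff σ ξ ζ‖ * (zpWeight ξ ^ N * zpWeight ζ ^ (d + 1))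
        ≤ ‖symbolCoeff σ ξ ζ‖ * (zpWeight ζ ^ K * zpWeight ζ ^ (d + 1)) := by
          gcongr
          exact hNK.trans (by gcongr)
      _ = zpWeight ζ ^ (d + 1 + K) * ‖symbolCoeff σ ξ ζ‖ := by rw [pow_add]; ring
      _ ≤ C₁ := h₁ ζ ξ
      _ ≤ _ := le_max_left _ _

/-- Fourier inversion turns the coefficient bounds into a pointwise bound, the weights
`⟨ζ⟩^(-(d+1))` being summable. Inversion holds only almost everywhere, whence the form of the
conclusion. -/
theorem IsHormanderSymbol.exists_norm_sub_blockSymbol_le (hσ : IsHormanderSymbol 0 ρ 0 σ)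
    (hρ : 0 < ρ) (hε : ρ / 2 < 1) (hint : ∀ ξ, Integrable (fun x => σ x ξ) (zpHaar p d))
    (h0 : Tendsto (fun ξ => ∫ x, ‖σ x ξ‖ ∂(zpHaar p d)) cofinite (𝓝 0)) (N : ℕ) :
    ∃ C : ℝ, 0 ≤ C ∧ ∀ ξ : ZpDual p d, ∀ᵐ x ∂(zpHaar p d),
      ‖σ x ξ - blockSymbol hε (symbolCoeff σ) x ξ‖ ≤ C * (zpWeight ξ ^ N)⁻¹ := by
  obtain ⟨C, hC⟩ := hσ.exists_symbolCoeff_sub_le hρ hε hint h0 N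
  have hC0 : 0 ≤ C := by
    have h := (norm_nonneg _).trans (hC 0 0)
    have h1 := zpWeight_pos (0 : ZpDual p d)
    rw [mul_assoc] at h
    exact nonneg_of_mul_nonneg_left h (by positivity)
  have hS := summable_zpWeight_inv_pow p d
  refine ⟨C * ∑' ζ : ZpDual p d, (zpWeight ζ ^ (d + 1))⁻¹,
    mul_nonneg hC0 (tsum_nonneg fun ζ => by have := zpWeight_pos ζ; positivity), fun ξ => ?_⟩
  set a : ZpDual p d → ℂ := (blockGroup (Quotient.mk _ ξ : FreqBlock p d hε) : Set _).indicator
    (symbolCoeff σ (Quotient.mk _ ξ : FreqBlock p d hε).out) with ha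
  have hsub : Summable fun ζ => ‖symbolCoeff σ ξ ζ - a ζ‖ :=
    Summable.of_nonneg_of_le (fun _ => norm_nonneg _) (hC ξ) (hS.mul_left _)
  have hasum : Summable fun ζ => ‖a ζ‖ := by
    refine summable_of_hasFiniteSupport ?_
    refine (finite_norm_le_zpDual p d
      (zpWeight (Quotient.mk _ ξ : FreqBlock p d hε).out ^ (ρ / 2))).subset ?_
    intro ζ hζ
    by_contra h
    exact hζ (by beta_reduce; rw [ha, Set.indicator_of_notMem (by exact h), norm_zero])
  have hcsum : Summable fun ζ => ‖symbolCoeff σ ξ ζ‖ := by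
    refine Summable.of_nonneg_of_le (fun _ => norm_nonneg _) (fun ζ => ?_) (hsub.add hasum)
    exact norm_le_norm_sub_add _ _
  have hchar : ∀ {b : ZpDual p d → ℂ}, Summable (fun ζ => ‖b ζ‖) → ∀ x,
      Summable fun ζ => b ζ * zpChar ζ x := fun hb x =>
    Summable.of_norm (by simpa only [norm_mul, norm_zpChar, mul_one] using hb)
  filter_upwards [ae_eq_tsum_zpFourier (hint ξ) hcsum] with x hx
  have h1 : blockSymbol hε (symbolCoeff σ) x ξ = ∑' ζ, a ζ * zpChar ζ x := by
    rw [blockSymbol, blockPoly, ← tsum_fintype (L := SummationFilter.unconditional _)]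
    refine (tsum_subtype (blockGroup (Quotient.mk _ ξ : FreqBlock p d hε) : Set _)
      (fun ζ => symbolCoeff σ (Quotient.mk _ ξ : FreqBlock p d hε).out ζ * zpChar ζ x)).trans
      (tsum_congr fun ζ => ?_)
    rw [ha, Set.indicator_mul_left]
  rw [hx, h1]
  change ‖∑' ζ, symbolCoeff σ ξ ζ * zpChar ζ x - _‖ ≤ _
  rw [← (hchar hcsum x).tsum_sub (hchar hasum x)]
  simp only [← sub_mul]
  have h2 : Summable fun ζ => ‖(symbolCoeff σ ξ ζ - a ζ) * zpChar ζ x‖ := by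
    simpa only [norm_mul, norm_zpChar, mul_one] using hsub
  refine (norm_tsum_le_tsum_norm h2).trans ?_
  rw [mul_right_comm, ← tsum_mul_left]
  refine h2.tsum_le_tsum (fun ζ => ?_) (hS.mul_left _)
  rw [norm_mul, norm_zpChar, mul_one]
  exact hC ξ ζ

theorem summable_rpow_norm_iff {ι E : Type*} [NormedAddCommGroup E] (f : ι → E) {γ : ℝ}
    (hγ : 0 ≤ γ) : Summable (fun i => ‖f i‖ ^ γ) ↔ ∑' i, ‖f i‖ₑ ^ γ < ∞ := by
  have h : ∀ i, ‖f i‖ₑ ^ γ = ((‖f i‖₊ ^ γ : NNReal) : ℝ≥0∞) := fun i => by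
    rw [ENNReal.coe_rpow_of_nonneg _ hγ]; rfl
  simp only [h, lt_top_iff_ne_top, ENNReal.tsum_coe_ne_top_iff_summable]
  rw [← NNReal.summable_coe]
  simp

/-- A perturbation with summable bounds does not affect the summability of the `L^γ` norms. -/
theorem tsum_eLpNorm_rpow_lt_top_of_sub_le {ι : Type*} {f g : ZpPow p d → ι → ℂ}
    (hf : ∀ i, AEStronglyMeasurable (fun x => f x i) (zpHaar p d))
    (hg : ∀ i, AEStronglyMeasurable (fun x => g x i) (zpHaar p d)) {γ : ℝ} (hγ : 1 ≤ γ)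
    {C : ℝ} (hC : 0 ≤ C) {w : ι → ℝ} (hw0 : ∀ i, 0 ≤ w i) (hw1 : ∀ i, w i ≤ 1) (hw : Summable w)
    (h : ∀ i, ∀ᵐ x ∂(zpHaar p d), ‖f x i - g x i‖ ≤ C * w i)
    (hsum : ∑' i, eLpNorm (fun x => g x i) (ENNReal.ofReal γ) (zpHaar p d) ^ γ < ∞) :
    ∑' i, eLpNorm (fun x => f x i) (ENNReal.ofReal γ) (zpHaar p d) ^ γ < ∞ := by
  have h1 : ∀ i, eLpNorm (fun x => f x i) (ENNReal.ofReal γ) (zpHaar p d) ^ γ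
      ≤ 2 ^ (γ - 1) * (ENNReal.ofReal (C ^ γ * w i)
        + eLpNorm (fun x => g x i) (ENNReal.ofReal γ) (zpHaar p d) ^ γ) := by
    intro i
    have h2 : eLpNorm (fun x => f x i - g x i) (ENNReal.ofReal γ) (zpHaar p d)
        ≤ ENNReal.ofReal (C * w i) := by
      have h3 := eLpNorm_le_of_ae_bound (p := ENNReal.ofReal γ) (h i)
      simpa using h3
    have h4 : eLpNorm (fun x => f x i) (ENNReal.ofReal γ) (zpHaar p d)
        ≤ ENNReal.ofReal (C * w i)
          + eLpNorm (fun x => g x i) (ENNReal.ofReal γ) (zpHaar p d) := by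
      have h5 := eLpNorm_add_le ((hf i).sub (hg i)) (hg i) (p := ENNReal.ofReal γ) (by simpa)
      rw [sub_add_cancel] at h5
      exact h5.trans (add_le_add_left h2 _)
    refine (ENNReal.rpow_le_rpow h4 (by linarith)).trans
      ((ENNReal.rpow_add_le_mul_rpow_add_rpow _ _ hγ).trans ?_)
    gcongr
    rw [ENNReal.ofReal_rpow_of_nonneg (mul_nonneg hC (hw0 i)) (by linarith)]
    refine ENNReal.ofReal_le_ofReal ?_
    rw [Real.mul_rpow hC (hw0 i)]
    gcongr
    exact Real.rpow_le_self_of_le_one (hw0 i) (hw1 i) hγ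
  refine (ENNReal.tsum_le_tsum h1).trans_lt ?_
  rw [ENNReal.tsum_mul_left, ENNReal.tsum_add]
  refine ENNReal.mul_lt_top (ENNReal.rpow_lt_top_of_nonneg (by linarith) (by simp))
    (ENNReal.add_lt_top.2 ⟨?_, hsum⟩)
  exact (hw.mul_left _).tsum_ofReal_lt_top

end BlockApproximation

/-! ### Mean decay of the symbol and the Schatten criterion. -/

section Main

open Filter Topology

variable {p : ℕ} [Fact p.Prime] {d : ℕ} {ρ : ℝ} {σ : ZpPow p d → ZpDual p d → ℂ}

/-- On a probability space the `L^q` norm dominates the `L^1` norm. It is used with `q = 2` for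
Schatten operators and with `q = γ` for symbols of finite sum. -/
theorem integrable_and_tendsto_of_eLpNorm (hσ : ∀ ξ, Measurable fun x => σ x ξ) {q : ℝ≥0∞}
    (hq : 1 ≤ q) (hfin : ∀ ξ, eLpNorm (fun x => σ x ξ) q (zpHaar p d) < ∞)
    (h : Tendsto (fun ξ => eLpNorm (fun x => σ x ξ) q (zpHaar p d)) cofinite (𝓝 0)) :
    (∀ ξ, Integrable (fun x => σ x ξ) (zpHaar p d)) ∧
      Tendsto (fun ξ => ∫ x, ‖σ x ξ‖ ∂(zpHaar p d)) cofinite (𝓝 0) := by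
  have hm : ∀ ξ, AEStronglyMeasurable (fun x => σ x ξ) (zpHaar p d) := fun ξ =>
    (hσ ξ).aestronglyMeasurable
  refine ⟨fun ξ => MemLp.integrable hq ⟨hm ξ, hfin ξ⟩, ?_⟩
  have h1 : Tendsto (fun ξ => eLpNorm (fun x => σ x ξ) 1 (zpHaar p d)) cofinite (𝓝 0) :=
    tendsto_of_tendsto_of_tendsto_of_le_of_le tendsto_const_nhds h (fun _ => zero_le)
      fun ξ => eLpNorm_le_eLpNorm_of_exponent_le hq (hm ξ)
  have h2 := (ENNReal.tendsto_toReal ENNReal.zero_ne_top).comp h1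
  refine h2.congr fun ξ => ?_
  rw [Function.comp, integral_norm_eq_lintegral_enorm (hm ξ), eLpNorm_one_eq_lintegral_enorm]

theorem IsBoundedExtension.integrable_and_tendsto {A : ZpL2 p d →L[ℂ] ZpL2 p d}
    (hA : IsBoundedExtension σ A) (hσ : ∀ ξ, Measurable fun x => σ x ξ) {γ : ℝ} (hγ : 0 < γ)
    (hS : IsSchatten γ A) : (∀ ξ, Integrable (fun x => σ x ξ) (zpHaar p d)) ∧
      Tendsto (fun ξ => ∫ x, ‖σ x ξ‖ ∂(zpHaar p d)) cofinite (𝓝 0) := by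
  have h1 : ∀ ξ, eLpNorm (fun x => σ x ξ) 2 (zpHaar p d) = ENNReal.ofReal ‖A (zpCharL2 ξ)‖ :=
    fun ξ => by
      rw [ofReal_norm, enorm_eq_of_ae_eq_mul_zpChar (isBoundedExtension_iff.1 hA ξ)]
  refine integrable_and_tendsto_of_eLpNorm hσ (q := 2) (by norm_num)
    (fun ξ => by rw [h1]; exact ENNReal.ofReal_lt_top) ?_
  simp only [h1]
  rw [← ENNReal.ofReal_zero]
  exact ENNReal.tendsto_ofReal (hS.tendsto_norm_apply (orthonormal_zpCharL2 p d) hγ)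

theorem integrable_and_tendsto_of_tsum (hσ : ∀ ξ, Measurable fun x => σ x ξ) {γ : ℝ} (hγ : 1 ≤ γ)
    (h : ∑' ξ, eLpNorm (fun x => σ x ξ) (ENNReal.ofReal γ) (zpHaar p d) ^ γ < ∞) :
    (∀ ξ, Integrable (fun x => σ x ξ) (zpHaar p d)) ∧
      Tendsto (fun ξ => ∫ x, ‖σ x ξ‖ ∂(zpHaar p d)) cofinite (𝓝 0) := by
  have hγ0 : 0 < γ := by linarith
  have h1 := ENNReal.tendsto_cofinite_zero_of_tsum_ne_top h.ne
  have h2 := ((ENNReal.continuous_rpow_const (y := γ⁻¹)).tendsto 0).comp h1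
  rw [ENNReal.zero_rpow_of_pos (by positivity)] at h2
  refine integrable_and_tendsto_of_eLpNorm hσ (q := ENNReal.ofReal γ) (by simpa) (fun ξ => ?_)
    (h2.congr fun ξ => ?_)
  · have h3 := (ENNReal.le_tsum ξ).trans_lt h
    exact (ENNReal.rpow_lt_top_iff_of_pos hγ0).1 h3
  · rw [Function.comp, ← ENNReal.rpow_mul, mul_inv_cancel₀ hγ0.ne', ENNReal.rpow_one]

theorem IsBoundedExtension.add {τ : ZpPow p d → ZpDual p d → ℂ} {A B : ZpL2 p d →L[ℂ] ZpL2 p d}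
    (hA : IsBoundedExtension σ A) (hB : IsBoundedExtension τ B) :
    IsBoundedExtension (fun x ξ => σ x ξ + τ x ξ) (A + B) := by
  rw [isBoundedExtension_iff] at *
  intro ξ
  filter_upwards [hA ξ, hB ξ, Lp.coeFn_add (A (zpCharL2 ξ)) (B (zpCharL2 ξ))] with x h1 h2 h3
  rw [_root_.add_apply, h3, Pi.add_apply, h1, h2, add_mul]

theorem IsBoundedExtension.sub {τ : ZpPow p d → ZpDual p d → ℂ} {A B : ZpL2 p d →L[ℂ] ZpL2 p d}
    (hA : IsBoundedExtension σ A) (hB : IsBoundedExtension τ B) :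
    IsBoundedExtension (fun x ξ => σ x ξ - τ x ξ) (A - B) := by
  rw [isBoundedExtension_iff] at *
  intro ξ
  filter_upwards [hA ξ, hB ξ, Lp.coeFn_sub (A (zpCharL2 ξ)) (B (zpCharL2 ξ))] with x h1 h2 h3
  rw [_root_.sub_apply, h3, Pi.sub_apply, h1, h2, sub_mul]

/-- Rapidly decreasing symbols give operators in all Schatten classes. -/
theorem exists_isBoundedExtension_isSchatten_of_le
    (hσ : ∀ ξ, AEStronglyMeasurable (fun x => σ x ξ) (zpHaar p d)) {C : ℝ}
    (h : ∀ ξ, ∀ᵐ x ∂(zpHaar p d), ‖σ x ξ‖ ≤ C * ((zpWeight ξ ^ (d + 1))⁻¹) ^ 2) {γ : ℝ}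
    (hγ : 1 ≤ γ) : ∃ E : ZpL2 p d →L[ℂ] ZpL2 p d, IsBoundedExtension σ E ∧ IsSchatten γ E := by
  have hm : ∀ ξ, MemLp (fun x => σ x ξ) 2 (zpHaar p d) := fun ξ => MemLp.of_bound (hσ ξ) _ (h ξ)
  choose v hv using fun ξ => exists_ae_eq_mul_zpChar (hm ξ) ξ
  have hvle : ∀ ξ, ‖v ξ‖ ≤ C * ((zpWeight ξ ^ (d + 1))⁻¹) ^ 2 := fun ξ => by
    have hnn : 0 ≤ C * ((zpWeight ξ ^ (d + 1))⁻¹) ^ 2 := by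
      obtain ⟨x, hx⟩ := (h ξ).exists
      exact (norm_nonneg _).trans hx
    have h1 := eLpNorm_le_of_ae_bound (p := 2) (h ξ)
    rw [← enorm_eq_of_ae_eq_mul_zpChar (hv ξ), measure_univ, ENNReal.one_rpow, one_mul,
      ← ofReal_norm] at h1
    exact (ENNReal.ofReal_le_ofReal_iff hnn).1 h1
  obtain ⟨E, hE, hES⟩ := (zpBasis p d).exists_isSchatten v (fun ξ => (zpWeight ξ ^ (d + 1))⁻¹)
    (fun ξ => by have := zpWeight_pos ξ; positivity)
    (fun ξ => inv_le_one_of_one_le₀ (one_le_pow₀ (one_le_zpWeight ξ)))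
    (summable_zpWeight_inv_pow p d) C hvle hγ
  refine ⟨E, isBoundedExtension_iff.2 fun ξ => ?_, hES⟩
  rw [← zpBasis_apply, hE]
  exact hv ξ

theorem exists_isBoundedExtension_blockSymbol {ε : ℝ} {hε : ε < 1}
    {c : ZpDual p d → ZpDual p d → ℂ} {γ : ℝ} (hγ : 0 < γ)
    (h : Summable fun i : Σ b : FreqBlock p d hε, AddChar (blockGroup b) ℂ =>
      ‖blockEigenvalue c i‖ ^ γ) :
    ∃ A : ZpL2 p d →L[ℂ] ZpL2 p d, IsBoundedExtension (blockSymbol hε c) A ∧ IsSchatten γ A := by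
  obtain ⟨A, hA⟩ := (blockBasis p d hε).blockFourier.exists_clm_diagonal (blockEigenvalue c)
    ((∑' i : Σ b : FreqBlock p d hε, AddChar (blockGroup b) ℂ, ‖blockEigenvalue c i‖ ^ γ) ^ γ⁻¹)
    fun i => by
      have h1 := h.le_tsum i fun _ _ => Real.rpow_nonneg (norm_nonneg _) _
      have h2 := Real.rpow_le_rpow (Real.rpow_nonneg (norm_nonneg _) _) h1 (inv_nonneg.2 hγ.le)
      rwa [← Real.rpow_mul (norm_nonneg _), mul_inv_cancel₀ hγ.ne', Real.rpow_one] at h2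
  exact ⟨A, blockFourier_apply_iff_isBoundedExtension.1 hA, isSchatten_of_diagonal _ hA hγ h⟩

/-- For the block symbol `τ` the two sides agree by diagonalisation. The operator of `σ - τ` lies in
`S_γ` and the norms of `σ - τ` are `γ`-summable, so each side holds for `σ` exactly when it holds
for `τ`. -/
theorem IsHormanderSymbol.exists_isSchatten_iff (hσ : IsHormanderSymbol 0 ρ 0 σ) (hρ : 0 < ρ)
    (hρ1 : ρ ≤ 1) {γ : ℝ} (hγ : 1 ≤ γ) (hint : ∀ ξ, Integrable (fun x => σ x ξ) (zpHaar p d))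
    (h0 : Tendsto (fun ξ => ∫ x, ‖σ x ξ‖ ∂(zpHaar p d)) cofinite (𝓝 0)) :
    (∃ A : ZpL2 p d →L[ℂ] ZpL2 p d, IsBoundedExtension σ A ∧ IsSchatten γ A) ↔
      ∑' ξ, eLpNorm (fun x => σ x ξ) (ENNReal.ofReal γ) (zpHaar p d) ^ γ < ∞ := by
  have hε : ρ / 2 < 1 := by linarith
  have hγ0 : 0 < γ := by linarith
  set τ := blockSymbol hε (symbolCoeff σ) with hτ
  have hσm : ∀ ξ, AEStronglyMeasurable (fun x => σ x ξ) (zpHaar p d) := fun ξ =>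
    (hσ.measurable ξ).aestronglyMeasurable
  have hτm : ∀ ξ, AEStronglyMeasurable (fun x => τ x ξ) (zpHaar p d) := fun ξ =>
    (continuous_blockSymbol ξ).aestronglyMeasurable
  obtain ⟨C₁, hC₁, h₁⟩ := hσ.exists_norm_sub_blockSymbol_le hρ hε hint h0 (d + 1)
  -- Twice the exponent: the Schatten bound for the error needs the square of a summable weight.
  obtain ⟨C₂, -, h₂⟩ := hσ.exists_norm_sub_blockSymbol_le hρ hε hint h0 ((d + 1) * 2)
  obtain ⟨E, hE, hES⟩ := exists_isBoundedExtension_isSchatten_of_le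
    (σ := fun x ξ => σ x ξ - τ x ξ) (fun ξ => (hσm ξ).sub (hτm ξ)) (C := C₂)
    (fun ξ => by simpa only [pow_mul, inv_pow] using h₂ ξ) hγ
  have hw0 : ∀ ξ : ZpDual p d, 0 ≤ (zpWeight ξ ^ (d + 1))⁻¹ := fun ξ => by
    have := zpWeight_pos ξ
    positivity
  have hw1 : ∀ ξ : ZpDual p d, (zpWeight ξ ^ (d + 1))⁻¹ ≤ 1 := fun ξ =>
    inv_le_one_of_one_le₀ (one_le_pow₀ (one_le_zpWeight ξ))
  have heig : Summable (fun i : Σ b : FreqBlock p d hε, AddChar (blockGroup b) ℂ =>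
      ‖blockEigenvalue (symbolCoeff σ) i‖ ^ γ) ↔
      ∑' ξ, eLpNorm (fun x => τ x ξ) (ENNReal.ofReal γ) (zpHaar p d) ^ γ < ∞ := by
    rw [summable_rpow_norm_iff _ hγ0.le, tsum_eLpNorm_blockSymbol hγ0]
  constructor
  · rintro ⟨A, hA, hAS⟩
    have h3 := hA.sub hE
    simp only [sub_sub_cancel] at h3
    have h4 := blockFourier_apply_iff_isBoundedExtension.2 h3
    have h5 := summable_of_isSchatten_diagonal (HilbertBasis.orthonormal _) h4 hγ0
      (hAS.sub hγ0 hES)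
    exact tsum_eLpNorm_rpow_lt_top_of_sub_le hσm hτm hγ hC₁ hw0 hw1
      (summable_zpWeight_inv_pow p d) h₁ (heig.1 h5)
  · intro h
    have h3 := tsum_eLpNorm_rpow_lt_top_of_sub_le hτm hσm hγ hC₁ hw0 hw1
      (summable_zpWeight_inv_pow p d)
      (fun ξ => (h₁ ξ).mono fun x hx => by rwa [norm_sub_rev]) h
    obtain ⟨A, hA, hAS⟩ := exists_isBoundedExtension_blockSymbol hγ0 (heig.2 h3)
    have h4 := hA.add hE
    simp only [← hτ, add_sub_cancel] at h4
    exact ⟨A + E, h4, hAS.add hγ0 hES⟩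

end Main

theorem mainTheorem4 (p : ℕ) [Fact p.Prime] (d : ℕ) (ρ : ℝ) (hρ0 : 0 ≤ ρ) (hρ1 : ρ ≤ 1)
    (σ : ZpPow p d → ZpDual p d → ℂ) (hσ : IsHormanderSymbol 0 ρ 0 σ) :
    (0 < ρ → ∀ γ : ℝ, 1 ≤ γ →
      ((∃ A : ZpL2 p d →L[ℂ] ZpL2 p d, IsBoundedExtension σ A ∧ IsSchatten γ A) ↔
        ∑' ξ : ZpDual p d,
          eLpNorm (fun x => σ x ξ) (ENNReal.ofReal γ) (zpHaar p d) ^ γ < ∞)) ∧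
    ((∃ A : ZpL2 p d →L[ℂ] ZpL2 p d, IsBoundedExtension σ A ∧ IsHilbertSchmidt A) ↔
      ∑' ξ : ZpDual p d, eLpNorm (fun x => σ x ξ) 2 (zpHaar p d) ^ 2 < ∞) ∧
    (∀ A : ZpL2 p d →L[ℂ] ZpL2 p d, IsBoundedExtension σ A →
      ∀ (ι : Type) (e : HilbertBasis ι ℂ (ZpL2 p d)),
        ∑' i, ‖A (e i)‖ₑ ^ 2 =
          ∑' ξ : ZpDual p d, eLpNorm (fun x => σ x ξ) 2 (zpHaar p d) ^ 2) := by
  refine ⟨fun hρ γ hγ => ?_, exists_isBoundedExtension_isHilbertSchmidt_iff hσ.measurable,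
    fun A hA ι e => hA.tsum_sq_enorm e⟩
  -- Each side of the equivalence separately provides the integrability and mean decay that the
  -- comparison with the block symbol requires.
  constructor
  · rintro ⟨A, hA, hS⟩
    obtain ⟨hint, h0⟩ := hA.integrable_and_tendsto hσ.measurable (by linarith) hS
    exact (hσ.exists_isSchatten_iff hρ hρ1 hγ hint h0).1 ⟨A, hA, hS⟩
  · intro h
    obtain ⟨hint, h0⟩ := integrable_and_tendsto_of_tsum hσ.measurable hγ h
    exact (hσ.exists_isSchatten_iff hρ hρ1 hγ hint h0).2 h
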